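/- \textbf{Setting.} Fix $E>0$ and $\alpha,\beta\in(0,1)$. For $N\ge 3$ let $\{\eta_t : t\ge 0\}$ be the boundary driven weakly asymmetric exclusion process on $\Sigma_N=\{0,1\}^{\{1,\dots,N-1\}}$, i.e. the continuous-time Markov process with right-continuous paths having left limits and generator $$(\mathcal L_N f)(\eta)=N^2\sum_{j=0}^{N-1}c_{j,j+1}(\eta)\{f(\sigma^{j,j+1}\eta)-f(\eta)\},$$ $$c_{j,j+1}(\eta)=\Big(1+\frac EN\Big)\eta(j)[1-\eta(j+1)]+\eta(j+1)[1-\eta(j)],$$ with the convention $\eta(0)=\alpha$, $\eta(N)=\beta$. Here $\sigma^{j,j+1}\eta$ is obtained from $\eta$ by exchanging $\eta(j)$ and $\eta(j+1)$ if $1\le j\le N-2$, by flipping $\eta(1)$ if $j=0$, and by flipping $\eta(N-1)$ if $j=N-1$. For a probability measure $\mu_N$ on $\Sigma_N$, $\mathbb E_{\mu_N}$ denotes the expectation for the process with initial law $\mu_N$. Let $J^{j,k}_t$, $|j-k|=1$, be the number of jumps from $j$ to $k$ in $(0,t]$ (for $j,k\in\{0,1\}$ and $j,k\in\{N-1,N\}$: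 creations and annihilations of particles at sites $1$ and $N-1$), and let $W^{j,j+1}_t=J^{j,j+1}_t-J^{j+1,j}_t$. Define $\gamma=\gamma_N$ by $e^{-\gamma/N}=1+E/N$ and $$\xi_t(j)=\exp\Big\{\frac{\gamma}{N}\Big[W^{j,j+1}_t-\sum_{k=1}^{j}\eta_0(k)\Big]\Big\},\qquad 0\le j\le N-1 .$$ Let $\rho_0:[0,1]\to[0,1]$ be of class $C^4([0,1])$ with $\rho_0(0)=\alpha$, $\rho_0(1)=\beta$, and let $\lambda_t=\lambda^N_t$ be the solution of the linear equation $$\partial_t\lambda_t(j)=(\Omega\lambda_t)(j),\qquad \lambda_0(j)=\exp\Big\{-\frac{\gamma}{N}\sum_{k=1}^{j}\rho_0(k/N)\Big\},\qquad 0\le j\le N-1,$$ where $$(\Omega f)(0)=-\alpha ENf(0)+N^2[f(1)-f(0)],$$ $$(\Omega f)(j)=N^2[f(j+1)+f(j-1)-2f(j)]-EN[f(j)-f(j-1)],\qquad 1\le j\le N-2,$$ $$(\Omega f)(N-1)=\beta ENf(N-1)-N^2\Big(1+\frac EN\Big)[f(N-1)-f(N-2)].$$ \textbf{Statement.} Let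 $E>0$, $\beta\in(0,1)$, $T>0$ and $A_2\in\mathbb R$. There exist finite constants $C_1$ and $N_0\ge 3$, depending only on $E$, $\beta$, $T$ and $A_2$, such that for all $\alpha$ and $\rho_0$ as above and every sequence $\{\mu_N:N\ge1\}$ of probability measures on $\Sigma_N$ satisfying $$\sup_{N\ge1}\ \max_{1\le k\le N-1}E_{\mu_N}\Big[\Big(\frac1{\sqrt N}\sum_{j=1}^{k}\{\eta(j)-\rho_0(j/N)\}\Big)^4\Big]\le A_2,$$ one has, for all $N\ge N_0$, $$\sup_{0\le t\le T}\ \max_{0\le j\le N-1}\mathbb E_{\mu_N}\big[(\xi_t(j)-\lambda_t(j))^4\big]\le\frac{C_1}{N^2}.$$ -/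

import Mathlib

open MeasureTheory Filter Topology Set
open scoped NNReal

noncomputable section

namespace WASEP

/-- The state space `{0,1}^{1,…,N-1}`; `true` means that the site is occupied. -/
abbrev Config (N : ℕ) : Type := ↥(Finset.Icc 1 (N - 1)) → Bool

/-- State of the site `k`, for `1 ≤ k ≤ N - 1` (and `false` at other integers). -/
def site {N : ℕ} (η : Config N) (k : ℕ) : Bool :=
  if h : k ∈ Finset.Icc 1 (N - 1) then η ⟨k, h⟩ else false

/-- The occupation variable `η(k)` with the boundary convention `η(0) = α`, `η(N) = β`. -/
def occ {N : ℕ} (α β : ℝ) (η : Config N) (k : ℕ) : ℝ :=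
  if k = 0 then α else if k = N then β else if site η k = true then 1 else 0

/-- Flip of the occupation variable at the site `j`. -/
def flip {N : ℕ} (j : ℕ) (η : Config N) : Config N :=
  fun k => if (k : ℕ) = j then !(η k) else η k

/-- Exchange of the occupation variables at the sites `j` and `j + 1`. -/
def exchange {N : ℕ} (j : ℕ) (η : Config N) : Config N :=
  fun k => if (k : ℕ) = j then site η (j + 1) else if (k : ℕ) = j + 1 then site η j else η k

/-- The configuration `σ^{j,j+1} η`: a flip of site `1` for `j = 0`, a flip of site `N - 1` for
`j = N - 1`, an exchange of the sites `j`, `j + 1` otherwise. -/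
def bondMove {N : ℕ} (j : ℕ) (η : Config N) : Config N :=
  if j = 0 then flip 1 η else if j + 1 = N then flip (N - 1) η else exchange j η

/-- The rate `c_{j,j+1}(η)`. -/
def rate {N : ℕ} (α β E : ℝ) (j : ℕ) (η : Config N) : ℝ :=
  (1 + E / N) * occ α β η j * (1 - occ α β η (j + 1)) + occ α β η (j + 1) * (1 - occ α β η j)

/-- The (speeded-up) generator acting on functions of the configuration. -/
def generator {N : ℕ} (α β E : ℝ) (f : Config N → ℝ) (η : Config N) : ℝ :=
  (N : ℝ) ^ 2 * ∑ j ∈ Finset.range N, rate α β E j η * (f (bondMove j η) - f η)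

/-- The generator as a matrix (rows: current state, columns: next state). -/
def genMatrix (α β E : ℝ) (N : ℕ) : Matrix (Config N) (Config N) ℝ :=
  Matrix.of fun ζ ζ' => generator α β E (Pi.single ζ' (1 : ℝ)) ζ

/-- The transition probabilities `e^{t L_N}`. -/
def transition (α β E : ℝ) (N : ℕ) (t : ℝ) : Matrix (Config N) (Config N) ℝ :=
  NormedSpace.exp (t • genMatrix α β E N)

/-- `X` is, under `P`, a version of the Markov process with generator `L_N` and initial law `μ`:
its paths are right continuous with left limits, and its finite-dimensional distributions are
those prescribed by `μ` and the semigroup `e^{t L_N}`. -/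
structure IsExclusionProcess (α β E : ℝ) (N : ℕ) (μ : Measure (Config N)) {S : Type*}
    [MeasurableSpace S] (P : Measure S) (X : ℝ≥0 → S → Config N) : Prop where
  measurable : ∀ t, Measurable (X t)
  right_continuous : ∀ ω t, ContinuousWithinAt (fun s => X s ω) (Ici t) t
  left_limits : ∀ ω t, 0 < t → ∃ ζ, Tendsto (fun s => X s ω) (𝓝[<] t) (𝓝 ζ)
  law : ∀ (n : ℕ) (t : Fin (n + 1) → ℝ≥0) (x : Fin (n + 1) → Config N), Monotone t → t 0 = 0 →
    P.real {ω | ∀ i, X (t i) ω = x i} =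
      μ.real {x 0} * ∏ i : Fin n,
        transition α β E N ((t i.succ : ℝ) - (t i.castSucc : ℝ)) (x i.castSucc) (x i.succ)

/-- The transition from `ζ` to `ζ'` is a jump of a particle from `j` to `j + 1`: the move is
`σ^{j,j+1}`, with `j` occupied (or a reservoir) and `j + 1` empty (or a reservoir). -/
def IsRightJump {N : ℕ} (j : ℕ) (ζ ζ' : Config N) : Prop :=
  ζ' = bondMove j ζ ∧ (j = 0 ∨ site ζ j = true) ∧ (j + 1 = N ∨ site ζ (j + 1) = false)

/-- The transition from `ζ` to `ζ'` is a jump of a particle from `j + 1` to `j`. -/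
def IsLeftJump {N : ℕ} (j : ℕ) (ζ ζ' : Config N) : Prop :=
  ζ' = bondMove j ζ ∧ (j + 1 = N ∨ site ζ (j + 1) = true) ∧ (j = 0 ∨ site ζ j = false)

/-- `J_t^{j,j+1}`: number of times `s ∈ (0,t]` at which the path `p` makes a jump from `j` to
`j + 1`; here `ζ` is the left limit of `p` at `s`. -/
def jumpsRight {N : ℕ} (p : ℝ≥0 → Config N) (j : ℕ) (t : ℝ≥0) : ℕ :=
  Set.ncard {s | s ∈ Ioc 0 t ∧ ∃ ζ, Tendsto p (𝓝[<] s) (𝓝 ζ) ∧ IsRightJump j ζ (p s)}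

/-- `J_t^{j+1,j}`: number of jumps of the path `p` from `j + 1` to `j` in `(0,t]`. -/
def jumpsLeft {N : ℕ} (p : ℝ≥0 → Config N) (j : ℕ) (t : ℝ≥0) : ℕ :=
  Set.ncard {s | s ∈ Ioc 0 t ∧ ∃ ζ, Tendsto p (𝓝[<] s) (𝓝 ζ) ∧ IsLeftJump j ζ (p s)}

/-- The total current `W_t^{j,j+1}`. -/
def current {N : ℕ} (p : ℝ≥0 → Config N) (j : ℕ) (t : ℝ≥0) : ℝ :=
  (jumpsRight p j t : ℝ) - (jumpsLeft p j t : ℝ)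

/-- The number `γ = γ_N`, for which `e^{-γ/N} = 1 + E/N`. -/
def gamma (E : ℝ) (N : ℕ) : ℝ := -((N : ℝ) * Real.log (1 + E / N))

/-- The microscopic Cole-Hopf variable `ξ_t(j)` of the path `p`. -/
def xi {N : ℕ} (E : ℝ) (p : ℝ≥0 → Config N) (t : ℝ≥0) (j : ℕ) : ℝ :=
  Real.exp (gamma E N / N *
    (current p j t - ∑ k ∈ Finset.Icc 1 j, if site (p 0) k = true then (1 : ℝ) else 0))

/-- `(∇_N^+ f)(j)`. -/
def gradPlus (N : ℕ) (f : ℕ → ℝ) (j : ℕ) : ℝ := N * (f (j + 1) - f j)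

/-- `(∇_N^- f)(j)`, used for `j ≥ 1`. -/
def gradMinus (N : ℕ) (f : ℕ → ℝ) (j : ℕ) : ℝ := -N * (f (j - 1) - f j)

/-- `(Δ_N f)(j)`, used for `j ≥ 1`. -/
def lap (N : ℕ) (f : ℕ → ℝ) (j : ℕ) : ℝ := (N : ℝ) ^ 2 * (f (j + 1) + f (j - 1) - 2 * f j)

/-- The operator `Ω` at a point `j ∈ {0, …, N-1}`; only the values of `f` on `{0, …, N-1}` enter
when `N ≥ 2`. -/
def Omega (α β E : ℝ) (N : ℕ) (f : ℕ → ℝ) (j : ℕ) : ℝ :=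
  if j = 0 then -α * E * N * f 0 + N * gradPlus N f 0
  else if j + 1 = N then β * E * N * f (N - 1) - N * (1 + E / N) * gradMinus N f (N - 1)
  else lap N f j - E * gradMinus N f j

/-- `lam` solves, for `t ≥ 0` and on `{0, …, N-1}`, the linear equation `∂_t λ_t = Ω λ_t` with
`λ_0(j) = exp (-(γ/N) ∑_{k=1}^j ρ₀(k/N))`. -/
structure IsLinearSolution (α β E : ℝ) (N : ℕ) (ρ₀ : ℝ → ℝ) (lam : ℝ → ℕ → ℝ) : Prop where
  deriv : ∀ t, 0 ≤ t → ∀ j < N,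
    HasDerivWithinAt (fun s => lam s j) (Omega α β E N (lam t) j) (Ici 0) t
  initial : ∀ j < N,
    lam 0 j = Real.exp (-(gamma E N / N) * ∑ k ∈ Finset.Icc 1 j, ρ₀ ((k : ℝ) / N))

/-- The initial fluctuation bound: the fourth moments of
`N^{-1/2} ∑_{j=1}^k (η(j) - ρ₀(j/N))` are at most `A` for all `N ≥ 1`, `1 ≤ k ≤ N - 1`. -/
def InitialBound (ρ₀ : ℝ → ℝ) (A : ℝ) (μ : (N : ℕ) → Measure (Config N)) : Prop :=
  ∀ N : ℕ, 1 ≤ N → ∀ k ∈ Finset.Icc 1 (N - 1),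
    ∫ η, (1 / Real.sqrt N *
      ∑ j ∈ Finset.Icc 1 k, ((if site η j = true then (1 : ℝ) else 0) - ρ₀ ((j : ℝ) / N))) ^ 4
        ∂(μ N) ≤ A

end WASEP

end

/-!
Fix the bond `{j, j + 1}`. The pair `(η_t, ξ_t(j))` is Markov, and
`ξ_t(k) = ξ_t(j) (1 + E / N) ^ (h_k(η_t) - h_j(η_t))`, where `h_k(η) = η(1) + ⋯ + η(k)`
(`weight`): a jump across `{k, k + 1}` changes `ξ(k)` and no other `ξ(i)` (`weight_bondMove`), and
the mean drift of `ξ` is exactly `Ω ξ` (`rate_mul_exp_height`).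

*From paths to matrices.* The current through the bond is eventually equal to the sum of the
currents read off along the partition points `t l / n` (`eventually_current_eq`). The moments of the
discretised `ξ_t(j)` are powers of matrices which converge, by Chernoff's product formula, to the
exponentials of tilted generators (`tendsto_integral_pathXi_pow`). This gives a functional
`polyMoment` on polynomials in `x = ξ_t(j)` with coefficients depending on `η_t`, which is positive
as a limit of expectations, has an explicit time derivative, and dominates the true expectations of
nonnegative polynomials by Fatou's lemma (`integrable_and_integral_le`). Only an upper bound being
wanted, no uniform integrability is needed.

*The fourth moment.* With `p_s = e^{(t - s)Ω}(a, ·)`, the process `U_s = ∑_k p_s(k) ξ_s(k)` is a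
martingale ending at `ξ_t(a)`, while `∑_k p_s(k) λ_s(k)` is constant, equal to `ℓ = λ_t(a)`. Each
jump of `U` is of size `O(p_s(k) ξ_s(k) / N)` and occurs at rate `O(N ^ 2)`, so that
`d/ds E[(U_s - ℓ)^4] ≤ C ∑_k p_s(k)^2 (v E[(U_s - ℓ)^4] + (1 / v + 1 / N^2) E[ξ_s(k)^4])`
for every `v > 0`. Gronwall's lemma is applied twice (`polyMoment_weight_le`): with `v = 1` and
`ℓ = 0` it bounds the moments of `ξ`, and with `v = N` it gives the theorem, the value at `s = 0`
being controlled by the assumption on the initial law (`sum_initial_error_le`).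

*The kernel.* What makes this work is `∫_0^t ∑_k p_s(k)^2 ds = O(1 / N)`
(`integral_sum_kernel_sq_le`) and the boundedness of the row sums (`sum_kernel_le`). `Ω` being
reversible for the weights `(1 + E / N) ^ (-k)`, the integral is at most a constant times the diagonal
of a Green function, which is `O(1 / N)` by the coercivity of the Dirichlet form and a discrete
Sobolev inequality (`coercivity`, `integral_kernel_diag_le`). The row sums are bounded by
comparison with an explicit supersolution (`Omega_cosh_le`).
-/

/-! ### Matrix exponentials and an integral inequality -/

namespace WASEP

theorem norm_pow_sub_pow_le {𝔸 : Type*} [NormedRing 𝔸] [NormOneClass 𝔸] {X Y : 𝔸} {r : ℝ}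
    (hr : 1 ≤ r) (hX : ‖X‖ ≤ r) (hY : ‖Y‖ ≤ r) (n : ℕ) :
    ‖X ^ n - Y ^ n‖ ≤ n * r ^ n * ‖X - Y‖ := by
  induction n with
  | zero => simp
  | succ n ih =>
    have hr0 : 0 ≤ r := by linarith
    have e : X ^ (n + 1) - Y ^ (n + 1) = (X ^ n - Y ^ n) * X + Y ^ n * (X - Y) := by
      rw [pow_succ, pow_succ]; noncomm_ring
    have h1 : ‖(X ^ n - Y ^ n) * X‖ ≤ (n * r ^ n * ‖X - Y‖) * r :=
      (norm_mul_le _ _).trans (mul_le_mul ih hX (norm_nonneg _) (by positivity))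
    have h2 : ‖Y ^ n * (X - Y)‖ ≤ r ^ n * ‖X - Y‖ :=
      (norm_mul_le _ _).trans (mul_le_mul_of_nonneg_right
        ((norm_pow_le _ _).trans (pow_le_pow_left₀ (norm_nonneg _) hY n)) (norm_nonneg _))
    have h3 : r ^ n * ‖X - Y‖ ≤ r ^ (n + 1) * ‖X - Y‖ :=
      mul_le_mul_of_nonneg_right (pow_le_pow_right₀ hr (Nat.le_succ n)) (norm_nonneg _)
    rw [e]
    refine (norm_add_le _ _).trans ?_
    push_cast
    calc _ ≤ (n * r ^ n * ‖X - Y‖) * r + r ^ (n + 1) * ‖X - Y‖ := by linarith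
      _ = _ := by ring

/-- Chernoff's product formula in a Banach algebra: only the value and the derivative at `0` of the
family `M` matter for the limit of `M (t / n) ^ n`. -/
theorem tendsto_pow_of_hasDerivAt {𝔸 : Type*} [NormedRing 𝔸] [NormOneClass 𝔸] [NormedAlgebra ℝ 𝔸]
    [CompleteSpace 𝔸] {M : ℝ → 𝔸} {B : 𝔸} (h0 : M 0 = 1) (hM : HasDerivAt M B 0) (t : ℝ) :
    Tendsto (fun n : ℕ => M (t / n) ^ n) atTop (𝓝 (NormedSpace.exp (t • B))) := by
  let _ : NormedAlgebra ℚ 𝔸 := NormedAlgebra.restrictScalars ℚ ℝ 𝔸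
  have hE : HasDerivAt (fun s : ℝ => NormedSpace.exp (s • B)) B 0 := by
    simpa using hasDerivAt_exp_smul_const (𝕂 := ℝ) B 0
  have htn : Tendsto (fun n : ℕ => t / n) atTop (𝓝 0) := tendsto_const_div_atTop_nhds_zero_nat t
  have hbound : ∀ {F : ℝ → 𝔸}, F 0 = 1 → HasDerivAt F B 0 →
      ∀ᶠ n : ℕ in atTop, ‖F (t / n)‖ ≤ Real.exp ((‖B‖ + 1) * |t| / n) := by
    intro F hF0 hF
    have h1 := (hasDerivAt_iff_isLittleO.1 hF).def one_pos
    filter_upwards [htn.eventually h1] with n hn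
    simp only [hF0, sub_zero, one_mul] at hn
    have h2 : ‖F (t / n)‖ ≤ ‖F (t / n) - 1 - (t / n) • B‖ + (‖(1 : 𝔸)‖ + ‖(t / n) • B‖) := by
      calc ‖F (t / n)‖ = ‖(F (t / n) - 1 - (t / n) • B) + (1 + (t / n) • B)‖ := by congr 1; abel
        _ ≤ _ := (norm_add_le _ _).trans (by gcongr; exact norm_add_le _ _)
    rw [norm_one, norm_smul] at h2
    have h3 : ‖t / (n : ℝ)‖ = |t| / n := by simp
    rw [h3] at h2 hn
    have h4 := Real.add_one_le_exp ((‖B‖ + 1) * |t| / n)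
    have h5 : (‖B‖ + 1) * |t| / n = |t| / n + |t| / n * ‖B‖ := by ring
    linarith
  have hdiff : Tendsto (fun n : ℕ => (n : ℝ) * ‖M (t / n) - NormedSpace.exp ((t / n) • B)‖)
      atTop (𝓝 0) := by
    have h1 := (hasDerivAt_iff_isLittleO.1 (hM.sub hE))
    simp only [Pi.sub_apply, h0, zero_smul, NormedSpace.exp_zero, sub_self, sub_zero, smul_zero]
      at h1
    have h2 := (h1.comp_tendsto htn)
    have h3 : (fun n : ℕ => (n : ℝ) * ‖M (t / n) - NormedSpace.exp ((t / n) • B)‖)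
        =o[atTop] fun n : ℕ => (n : ℝ) * (t / n) :=
      (Asymptotics.isBigO_refl _ _).mul_isLittleO h2.norm_left
    have hO : (fun n : ℕ => (n : ℝ) * (t / n)) =O[atTop] fun _ => (1 : ℝ) := by
      refine Asymptotics.IsBigO.of_bound |t| (Eventually.of_forall fun n => ?_)
      rcases eq_or_ne n 0 with rfl | hn
      · simp
      · have : (n : ℝ) ≠ 0 := by exact_mod_cast hn
        rw [mul_div_cancel₀ _ this]; simp
    exact (Asymptotics.isLittleO_one_iff ℝ).1 (h3.trans_isBigO hO)
  rw [tendsto_iff_norm_sub_tendsto_zero]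
  refine squeeze_zero' (Eventually.of_forall fun _ => norm_nonneg _) ?_
    (by simpa using hdiff.mul_const (Real.exp ((‖B‖ + 1) * |t|)))
  filter_upwards [hbound h0 hM, hbound (by simp) hE, eventually_gt_atTop 0] with n h1 h2 hn
  have hn' : (n : ℝ) ≠ 0 := by exact_mod_cast hn.ne'
  have e1 : NormedSpace.exp (t • B) = NormedSpace.exp ((t / n) • B) ^ n := by
    rw [← NormedSpace.exp_nsmul, ← Nat.cast_smul_eq_nsmul ℝ, smul_smul, mul_div_cancel₀ _ hn']
  have e2 : Real.exp ((‖B‖ + 1) * |t| / n) ^ n = Real.exp ((‖B‖ + 1) * |t|) := by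
    rw [← Real.exp_nat_mul, mul_div_cancel₀ _ hn']
  rw [e1]
  refine (norm_pow_sub_pow_le (Real.one_le_exp (by positivity)) h1 h2 n).trans (le_of_eq ?_)
  rw [e2]; ring

section Matrix

open scoped Matrix Matrix.Norms.Operator

variable {ι : Type*} [Fintype ι] [DecidableEq ι]

theorem hasDerivAt_matrix_iff {M : ℝ → Matrix ι ι ℝ} {M' : Matrix ι ι ℝ} {t : ℝ} :
    HasDerivAt M M' t ↔ ∀ i k, HasDerivAt (fun s => M s i k) (M' i k) t := by
  constructor
  · intro h i k
    let L : Matrix ι ι ℝ →ₗ[ℝ] ℝ :=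
      { toFun := fun A => A i k, map_add' := fun _ _ => rfl, map_smul' := fun _ _ => rfl }
    exact (LinearMap.toContinuousLinearMap L).hasFDerivAt.comp_hasDerivAt t h
  · intro h
    have e : ∀ A : Matrix ι ι ℝ, A = ∑ i, ∑ k, A i k • Matrix.single i k (1 : ℝ) := by
      intro A
      conv_lhs => rw [Matrix.matrix_eq_sum_single A]
      simp [Matrix.smul_single]
    have h2 : HasDerivAt (fun s => ∑ i, ∑ k, M s i k • Matrix.single i k (1 : ℝ))
        (∑ i, ∑ k, M' i k • Matrix.single i k (1 : ℝ)) t :=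
      HasDerivAt.fun_sum fun i _ => HasDerivAt.fun_sum fun k _ => (h i k).smul_const _
    rw [← e] at h2
    simpa only [← e] using h2

theorem hasDerivAt_exp_entry (A : Matrix ι ι ℝ) (t : ℝ) (i k : ι) :
    HasDerivAt (fun s : ℝ => NormedSpace.exp (s • A) i k) ((NormedSpace.exp (t • A) * A) i k) t :=
  hasDerivAt_matrix_iff.1 (hasDerivAt_exp_smul_const (𝕂 := ℝ) A t) i k

theorem hasDerivAt_exp_entry' (A : Matrix ι ι ℝ) (t : ℝ) (i k : ι) :
    HasDerivAt (fun s : ℝ => NormedSpace.exp (s • A) i k) ((A * NormedSpace.exp (t • A)) i k) t :=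
  hasDerivAt_matrix_iff.1 (hasDerivAt_exp_smul_const' (𝕂 := ℝ) A t) i k

theorem exp_add_smul (A : Matrix ι ι ℝ) (s t : ℝ) :
    NormedSpace.exp ((s + t) • A) = NormedSpace.exp (s • A) * NormedSpace.exp (t • A) := by
  rw [add_smul]
  exact Matrix.exp_add_of_commute _ _ ((Commute.refl A).smul_left s |>.smul_right t)

/-- Entrywise form of Chernoff's product formula. -/
theorem tendsto_matrix_pow_entry [Nonempty ι] {M : ℝ → Matrix ι ι ℝ} {B : Matrix ι ι ℝ}
    (h0 : M 0 = 1) (hM : ∀ i k, HasDerivAt (fun s => M s i k) (B i k) 0) (t : ℝ) (i k : ι) :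
    Tendsto (fun n : ℕ => (M (t / n) ^ n) i k) atTop (𝓝 (NormedSpace.exp (t • B) i k)) := by
  have h := tendsto_pow_of_hasDerivAt h0 (hasDerivAt_matrix_iff.2 hM) t
  exact ((continuous_id.matrix_elem i k).tendsto _).comp h

theorem matrix_pow_nonneg {A : Matrix ι ι ℝ} (hA : ∀ i k, 0 ≤ A i k) (n : ℕ) (i k : ι) :
    0 ≤ (A ^ n) i k := by
  induction n generalizing i k with
  | zero => by_cases h : i = k <;> simp [h]
  | succ n ih =>
    rw [pow_succ, Matrix.mul_apply]
    exact Finset.sum_nonneg fun l _ => mul_nonneg (ih i l) (hA l k)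

/-- The exponential of a matrix with nonnegative off-diagonal entries is nonnegative: it is the
limit of `(1 + (t / n) A) ^ n`, which is a nonnegative matrix for large `n`. -/
theorem exp_nonneg_of_offDiag_nonneg {A : Matrix ι ι ℝ} (hA : ∀ i k, i ≠ k → 0 ≤ A i k) {t : ℝ}
    (ht : 0 ≤ t) (i k : ι) : 0 ≤ NormedSpace.exp (t • A) i k := by
  have : Nonempty ι := ⟨i⟩
  have hd : ∀ a b, HasDerivAt (fun s : ℝ => ((1 : Matrix ι ι ℝ) + s • A) a b) (A a b) 0 := by
    intro a b
    have h1 := ((hasDerivAt_id (0 : ℝ)).mul_const (A a b)).const_add ((1 : Matrix ι ι ℝ) a b)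
    simpa using h1
  have h := tendsto_matrix_pow_entry (M := fun s => 1 + s • A) (by simp) hd t i k
  refine ge_of_tendsto h ?_
  have h2 : ∀ l, ∀ᶠ n : ℕ in atTop, 0 ≤ 1 + t / n * A l l := fun l => by
    have h3 : Tendsto (fun n : ℕ => 1 + t / n * A l l) atTop (𝓝 (1 + 0 * A l l)) :=
      ((tendsto_const_div_atTop_nhds_zero_nat t).mul_const _).const_add _
    filter_upwards [h3.eventually (lt_mem_nhds (a := 0) (by simp))] with n hn using hn.le
  filter_upwards [eventually_all.2 h2] with n hn
  refine matrix_pow_nonneg (fun a b => ?_) n i k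
  rcases eq_or_ne a b with rfl | hab
  · simpa using hn a
  · simpa [Matrix.one_apply, hab] using mul_nonneg (by positivity) (hA a b hab)

end Matrix

/-- A Gronwall inequality with an integrable rate `κ`. -/
theorem gronwall_integral_rate {y y' κ : ℝ → ℝ} {t A B : ℝ} (ht : 0 ≤ t) (hA : 0 ≤ A)
    (hB : 0 ≤ B) (hκ : Continuous κ) (hκ0 : ∀ s ∈ Icc 0 t, 0 ≤ κ s)
    (hy : ∀ s ∈ Icc 0 t, HasDerivWithinAt y (y' s) (Icc 0 t) s)
    (hle : ∀ s ∈ Icc 0 t, y' s ≤ κ s * (A * y s + B)) :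
    y t ≤ Real.exp (A * ∫ s in (0 : ℝ)..t, κ s) * (y 0 + B * ∫ s in (0 : ℝ)..t, κ s) := by
  set k : ℝ → ℝ := fun s => ∫ r in (0 : ℝ)..s, κ r with hk
  have hkd : ∀ s, HasDerivAt k (κ s) s := fun s =>
    intervalIntegral.integral_hasDerivAt_right (hκ.intervalIntegrable _ _)
      (hκ.stronglyMeasurableAtFilter _ _) hκ.continuousAt
  have hkn : ∀ s ∈ Icc 0 t, 0 ≤ k s := fun s hs =>
    intervalIntegral.integral_nonneg hs.1 fun r hr => hκ0 r ⟨hr.1, hr.2.trans hs.2⟩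
  -- this function is nonincreasing
  set φ : ℝ → ℝ := fun s => Real.exp (-(A * k s)) * y s - B * k s with hφ
  have hφd : ∀ s ∈ Icc 0 t, HasDerivWithinAt φ
      (Real.exp (-(A * k s)) * (-(A * κ s)) * y s + Real.exp (-(A * k s)) * y' s - B * κ s)
      (Icc 0 t) s := fun s hs =>
    ((((hkd s).const_mul A).neg.exp.hasDerivWithinAt).mul (hy s hs)).sub
      ((hkd s).const_mul B).hasDerivWithinAt
  have hanti : AntitoneOn φ (Icc 0 t) := by
    refine antitoneOn_of_hasDerivWithinAt_nonpos (convex_Icc 0 t)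
      (fun s hs => (hφd s hs).continuousWithinAt)
      (fun s hs => (hφd s (interior_subset hs)).mono interior_subset) fun s hs => ?_
    have hs' := interior_subset hs
    have h1 : Real.exp (-(A * k s)) ≤ 1 :=
      Real.exp_le_one_iff.2 (by have := mul_nonneg hA (hkn s hs'); linarith)
    have h2 := mul_le_mul_of_nonneg_left (hle s hs') (Real.exp_pos (-(A * k s))).le
    have h3 := mul_le_mul_of_nonneg_right h1 (mul_nonneg hB (hκ0 s hs'))
    nlinarith
  have h := hanti (left_mem_Icc.2 ht) (right_mem_Icc.2 ht) ht
  simp only [hφ] at h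
  have hk0 : k 0 = 0 := by simp [hk]
  rw [hk0] at h
  simp only [mul_zero, neg_zero, Real.exp_zero, one_mul, sub_zero] at h
  have h3 : y t = Real.exp (A * k t) * (Real.exp (-(A * k t)) * y t) := by
    rw [← mul_assoc, ← Real.exp_add]; simp
  rw [h3]
  exact mul_le_mul_of_nonneg_left (by linarith) (Real.exp_pos _).le

end WASEP

/-! ### The operator `Ω` and its kernel -/

namespace WASEP

variable {α β E : ℝ} {N : ℕ}

theorem Omega_eq (hN : 2 ≤ N) (f : ℕ → ℝ) {i : ℕ} (hi : i < N) :
    Omega α β E N f i = (if i + 1 < N then (N : ℝ) ^ 2 * (f (i + 1) - f i) else 0)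
      - (if 0 < i then (N : ℝ) ^ 2 * (1 + E / N) * (f i - f (i - 1)) else 0)
      + (if i = 0 then -(α * E * N * f i) else 0) + (if i + 1 = N then β * E * N * f i else 0) := by
  have hN0 : (N : ℝ) ≠ 0 := by positivity
  unfold Omega gradPlus gradMinus lap
  rcases Nat.eq_zero_or_pos i with rfl | h0
  · have h1 : 0 + 1 < N := by omega
    have h2 : 0 + 1 ≠ N := by omega
    simp only [h1, h2, if_true, if_false, lt_irrefl]
    ring
  · by_cases h1 : i + 1 = N
    · have h2 : N - 1 = i := by omega
      have h3 : ¬ i + 1 < N := by omega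
      simp only [h1, h2, h0, h0.ne', if_true, if_false, lt_irrefl]
      ring
    · have h3 : i + 1 < N := by omega
      simp only [h1, h3, h0, h0.ne', if_true, if_false]
      field_simp
      ring

/-- The matrix of `Ω` on functions on `{0, …, N - 1}`. -/
noncomputable def omegaMatrix (α β E : ℝ) (N : ℕ) : Matrix (Fin N) (Fin N) ℝ :=
  Matrix.of fun i k => Omega α β E N (Pi.single (k : ℕ) (1 : ℝ)) i

theorem sum_omegaMatrix_mul (hN : 2 ≤ N) (f : ℕ → ℝ) (i : Fin N) :
    ∑ k : Fin N, omegaMatrix α β E N i k * f k = Omega α β E N f i := by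
  have key : ∀ l < N, ∑ k : Fin N, f k * (Pi.single (k : ℕ) (1 : ℝ) : ℕ → ℝ) l = f l := by
    intro l hl
    rw [Finset.sum_eq_single (⟨l, hl⟩ : Fin N)]
    · simp
    · intro b _ hb
      have : l ≠ (b : ℕ) := fun h => hb (Fin.ext h.symm)
      simp [this]
    · simp
  have hl : ∀ l < N, ∀ c : ℝ, ∑ k : Fin N, c * (Pi.single (k : ℕ) (1 : ℝ) : ℕ → ℝ) l * f k
      = c * f l := by
    intro l hl c
    rw [← key l hl, Finset.mul_sum]
    exact Finset.sum_congr rfl fun k _ => by ring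
  have hi := i.2
  simp only [omegaMatrix, Matrix.of_apply]
  rw [Omega_eq hN f hi]
  simp only [Omega_eq hN _ hi]
  simp only [add_mul, sub_mul, Finset.sum_add_distrib, Finset.sum_sub_distrib, ite_mul, zero_mul,
    mul_sub, neg_mul]
  congr 1
  · congr 1
    · congr 1
      · split_ifs with h
        · simp only [Finset.sum_sub_distrib]
          rw [hl _ h, hl _ hi]
        · simp
      · split_ifs with h
        · simp only [Finset.sum_sub_distrib]
          rw [hl _ hi, hl _ (by omega)]
        · simp
    · split_ifs with h
      · simp only [Finset.sum_neg_distrib]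
        rw [hl _ hi]
      · simp
  · split_ifs with h
    · rw [hl _ hi]
    · simp

theorem omegaMatrix_apply_of_ne (hN : 2 ≤ N) {i k : Fin N} (h : i ≠ k) :
    omegaMatrix α β E N i k = if (k : ℕ) = i + 1 then (N : ℝ) ^ 2
      else if (i : ℕ) = k + 1 then (N : ℝ) ^ 2 * (1 + E / N) else 0 := by
  have hv : (i : ℕ) ≠ k := fun e => h (Fin.ext e)
  have hi := i.2
  have hk := k.2
  simp only [omegaMatrix, Matrix.of_apply]
  rw [Omega_eq hN _ hi]
  simp only [Pi.single_apply, hv, if_false, mul_zero, neg_zero, ite_self, add_zero, sub_zero,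
    zero_sub, mul_neg]
  by_cases h1 : (k : ℕ) = i + 1
  · have h2 : (i : ℕ) + 1 < N := by omega
    have h3 : (i : ℕ) - 1 ≠ k := by omega
    simp [h1, h2]
  · have h1' : (i : ℕ) + 1 ≠ k := fun e => h1 e.symm
    by_cases h2 : (i : ℕ) = k + 1
    · have h6 : (k : ℕ) ≠ k + 1 + 1 := by omega
      have h7 : (k : ℕ) + 1 + 1 ≠ k := by omega
      simp [h2, h6, h7]
    · by_cases h5 : 0 < (i : ℕ)
      · have h3 : (i : ℕ) - 1 ≠ k := by omega
        simp [h1, h1', h2, h3]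
      · simp [h1, h1', h2, h5]

/-- The kernel `e^{tΩ}` of the linear equation. -/
noncomputable def kernel (α β E : ℝ) (N : ℕ) (t : ℝ) : Matrix (Fin N) (Fin N) ℝ :=
  NormedSpace.exp (t • omegaMatrix α β E N)

theorem kernel_nonneg (hE : 0 < E) (hN : 2 ≤ N) {t : ℝ} (ht : 0 ≤ t) (i k : Fin N) :
    0 ≤ kernel α β E N t i k := by
  refine exp_nonneg_of_offDiag_nonneg (fun i k h => ?_) ht i k
  rw [omegaMatrix_apply_of_ne hN h]
  split_ifs <;> positivity

theorem kernel_zero : kernel α β E N 0 = 1 := by simp [kernel]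

theorem hasDerivAt_kernel (t : ℝ) (i k : Fin N) :
    HasDerivAt (fun s => kernel α β E N s i k)
      (∑ l, kernel α β E N t i l * omegaMatrix α β E N l k) t :=
  hasDerivAt_exp_entry _ t i k

theorem continuous_kernel (i k : Fin N) : Continuous fun s => kernel α β E N s i k :=
  continuous_iff_continuousAt.2 fun t => (hasDerivAt_kernel t i k).continuousAt

/-- Detailed balance: `Ω` is reversible with respect to the weights `(1 + E / N) ^ (-k)`. -/
theorem kernel_detailed_balance (hE : 0 < E) (hN : 2 ≤ N) (t : ℝ) (i k : Fin N) :
    ((1 + E / N) ^ (i : ℕ))⁻¹ * kernel α β E N t i k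
      = ((1 + E / N) ^ (k : ℕ))⁻¹ * kernel α β E N t k i := by
  have hq : (0 : ℝ) < 1 + E / N := by positivity
  set v : Fin N → ℝ := fun i => ((1 + E / N) ^ (i : ℕ))⁻¹ with hv
  have hv0 : ∀ i, v i ≠ 0 := fun i => by positivity
  set D := Matrix.diagonal v with hD
  have hu : IsUnit D := by
    rw [Matrix.isUnit_iff_isUnit_det, hD, Matrix.det_diagonal, isUnit_iff_ne_zero]
    exact Finset.prod_ne_zero_iff.2 fun i _ => hv0 i
  have hdet : IsUnit D.det := (Matrix.isUnit_iff_isUnit_det D).1 hu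
  have hcomm : D * omegaMatrix α β E N = (omegaMatrix α β E N).transpose * D := by
    ext i k
    rw [hD, Matrix.diagonal_mul, Matrix.mul_diagonal, Matrix.transpose_apply]
    rcases eq_or_ne i k with rfl | h
    · ring
    · rw [omegaMatrix_apply_of_ne hN h, omegaMatrix_apply_of_ne hN h.symm]
      by_cases h1 : (k : ℕ) = i + 1
      · have h2 : (i : ℕ) ≠ k + 1 := by omega
        simp only [h1, hv, if_true]
        rw [if_neg (by omega), pow_succ (1 + E / (N : ℝ))]
        clear_value D
        generalize 1 + E / (N : ℝ) = q at hq
        field_simp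
      · by_cases h2 : (i : ℕ) = k + 1
        · simp only [h2, hv, if_true]
          rw [if_neg (by omega), pow_succ (1 + E / (N : ℝ))]
          clear_value D
          generalize 1 + E / (N : ℝ) = q at hq
          field_simp
        · simp [h1, h2]
  -- conjugation by the weights turns `Ω` into its transpose, hence also its exponential
  have hconj : D * (t • omegaMatrix α β E N) * D⁻¹ = (t • omegaMatrix α β E N).transpose := by
    rw [Matrix.mul_smul, hcomm, Matrix.smul_mul, Matrix.mul_assoc, Matrix.mul_nonsing_inv _ hdet,
      Matrix.mul_one, Matrix.transpose_smul]
  have h := Matrix.exp_conj D (t • omegaMatrix α β E N) hu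
  rw [hconj, Matrix.exp_transpose] at h
  have h2 : (kernel α β E N t).transpose * D = D * kernel α β E N t := by
    unfold kernel
    rw [h, Matrix.mul_assoc, Matrix.nonsing_inv_mul _ hdet, Matrix.mul_one]
  have h3 := congrFun (congrFun h2 i) k
  rw [hD, Matrix.diagonal_mul, Matrix.mul_diagonal, Matrix.transpose_apply] at h3
  rw [← h3]
  ring

theorem pow_one_add_div_le_exp {K : ℝ} (hK : 0 ≤ K) {k : ℕ} (hk : k ≤ N) :
    (1 + K / N) ^ k ≤ Real.exp K := by
  rcases Nat.eq_zero_or_pos N with rfl | hN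
  · have : k = 0 := by omega
    simpa [this] using hK
  · calc (1 + K / N) ^ k ≤ (1 + K / N) ^ N := pow_le_pow_right₀ (by simp; positivity) hk
      _ ≤ Real.exp (K / N) ^ N := by
        refine pow_le_pow_left₀ (by positivity) ?_ N
        linarith [Real.add_one_le_exp (K / N)]
      _ = Real.exp K := by rw [← Real.exp_nat_mul, mul_div_cancel₀]; positivity

theorem exp_neg_le_inv_pow (hE : 0 < E) {k : ℕ} (hk : k ≤ N) :
    Real.exp (-E) ≤ ((1 + E / N) ^ k)⁻¹ := by
  rw [Real.exp_neg]
  exact inv_anti₀ (by positivity) (pow_one_add_div_le_exp hE.le hk)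

/-- By detailed balance the squares `e^{sΩ}(a, k)^2` are comparable to the return probabilities
`e^{sΩ}(a, k) e^{sΩ}(k, a)`. -/
theorem sum_kernel_sq_le (hE : 0 < E) (hN : 2 ≤ N) {s : ℝ} (hs : 0 ≤ s) (a : Fin N) :
    ∑ k, kernel α β E N s a k ^ 2 ≤ Real.exp E * kernel α β E N (s + s) a a := by
  have hq : (1 : ℝ) ≤ 1 + E / N := by simp; positivity
  have e : kernel α β E N (s + s) = kernel α β E N s * kernel α β E N s := exp_add_smul _ s s
  rw [e, Matrix.mul_apply, Finset.mul_sum]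
  refine Finset.sum_le_sum fun k _ => ?_
  have h1 := kernel_detailed_balance (α := α) (β := β) hE hN s a k
  have h2 := exp_neg_le_inv_pow hE (N := N) a.2.le
  have h3 : ((1 + E / N) ^ (k : ℕ))⁻¹ ≤ 1 := inv_le_one_of_one_le₀ (one_le_pow₀ hq)
  have p1 := kernel_nonneg (α := α) (β := β) hE hN hs a k
  have p2 := kernel_nonneg (α := α) (β := β) hE hN hs k a
  have h4 : Real.exp (-E) * kernel α β E N s a k ≤ kernel α β E N s k a :=
    calc _ ≤ ((1 + E / N) ^ (a : ℕ))⁻¹ * kernel α β E N s a k := mul_le_mul_of_nonneg_right h2 p1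
      _ = ((1 + E / N) ^ (k : ℕ))⁻¹ * kernel α β E N s k a := h1
      _ ≤ 1 * kernel α β E N s k a := mul_le_mul_of_nonneg_right h3 p2
      _ = _ := one_mul _
  have h5 : kernel α β E N s a k = Real.exp E * (Real.exp (-E) * kernel α β E N s a k) := by
    rw [← mul_assoc, ← Real.exp_add]; simp
  calc kernel α β E N s a k ^ 2
      = kernel α β E N s a k * (Real.exp E * (Real.exp (-E) * kernel α β E N s a k)) := by
        rw [← h5, sq]
    _ ≤ kernel α β E N s a k * (Real.exp E * kernel α β E N s k a) := by gcongr
    _ = _ := by ring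

/-! ### Row sums of the kernel -/

/-- The function `r ^ k + r ^ (-k)` with `r = 1 + (3 E + 3) / N` is a supersolution: it is flat to
second order at `0`, so that the killing rate there may be arbitrarily small, and steep enough at
`N - 1` to beat the creation term. -/
theorem Omega_cosh_le (hE : 0 < E) (hα : 0 ≤ α) (hβ : β ≤ 1) (hN : 3 ≤ N)
    (hN' : 6 * E + 6 ≤ N) {k : ℕ} (hk : k < N) :
    Omega α β E N (fun k => (1 + (3 * E + 3) / N) ^ k + ((1 + (3 * E + 3) / N)⁻¹) ^ k) k
      ≤ (3 * E + 3) ^ 2 * ((1 + (3 * E + 3) / N) ^ k + ((1 + (3 * E + 3) / N)⁻¹) ^ k) := by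
  have hNpos : (0 : ℝ) < N := by positivity
  set K := 3 * E + 3 with hK
  have hKpos : 0 < K := by positivity
  set r := 1 + K / N with hr
  have hd : r - 1 = K / N := by rw [hr]; ring
  have hr1 : 1 ≤ r := by rw [hr]; simp; positivity
  have hr0 : 0 < r := by linarith
  have hrle : r ≤ 3 / 2 := by
    have : K / N ≤ 1 / 2 := by rw [div_le_iff₀ hNpos]; linarith
    linarith
  set s := r⁻¹ with hs
  have hs0 : 0 < s := inv_pos.2 hr0
  have hrs : r * s = 1 := mul_inv_cancel₀ hr0.ne'
  have hs1 : s ≤ 1 := inv_le_one_of_one_le₀ hr1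
  have hds : 1 - s = (r - 1) * s := by rw [sub_mul, hrs]; ring
  have hNd : (N : ℝ) * (r - 1) = K := by rw [hd]; field_simp
  have hpow : ∀ l : ℕ, s ^ l ≤ 1 ∧ 1 ≤ r ^ l ∧ 0 < s ^ l := fun l =>
    ⟨pow_le_one₀ hs0.le hs1, one_le_pow₀ hr1, pow_pos hs0 l⟩
  -- the two second differences
  have hlapr : ∀ l : ℕ, (N : ℝ) ^ 2 * (r ^ (l + 2) + r ^ l - 2 * r ^ (l + 1))
      ≤ K ^ 2 * r ^ (l + 1) := by
    intro l
    have e : (N : ℝ) ^ 2 * (r ^ (l + 2) + r ^ l - 2 * r ^ (l + 1)) = K ^ 2 * r ^ l := by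
      rw [← hNd]; ring
    rw [e]
    exact mul_le_mul_of_nonneg_left (pow_le_pow_right₀ hr1 (Nat.le_succ l)) (by positivity)
  have hlaps : ∀ l : ℕ, (N : ℝ) ^ 2 * (s ^ (l + 2) + s ^ l - 2 * s ^ (l + 1))
      ≤ K ^ 2 * s ^ (l + 1) := by
    intro l
    have e : (N : ℝ) ^ 2 * (s ^ (l + 2) + s ^ l - 2 * s ^ (l + 1)) = K ^ 2 * (s ^ (l + 1) * s) := by
      have : s ^ (l + 2) + s ^ l - 2 * s ^ (l + 1) = s ^ l * (1 - s) ^ 2 := by ring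
      rw [this, hds, ← hNd]; ring
    rw [e]
    have := (hpow (l + 1)).2.2
    gcongr
    exact mul_le_of_le_one_right this.le hs1
  have hmono : ∀ l : ℕ, 0 ≤ (r ^ (l + 1) + s ^ (l + 1)) - (r ^ l + s ^ l) := by
    intro l
    have e : (r ^ (l + 1) + s ^ (l + 1)) - (r ^ l + s ^ l) = (r - 1) * (r ^ l - s ^ l * s) := by
      have : (r - 1) * (r ^ l - s ^ l * s) = r ^ l * r - r ^ l - s ^ l * ((r - 1) * s) := by ring
      rw [this, ← hds]; ring
    rw [e]
    refine mul_nonneg (by linarith) ?_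
    have h1 := hpow l
    have : s ^ l * s ≤ 1 * 1 := mul_le_mul h1.1 hs1 hs0.le zero_le_one
    linarith
  rcases Nat.eq_zero_or_pos k with rfl | h0
  · unfold Omega gradPlus
    simp only [if_true, zero_add, pow_one, pow_zero]
    have h1 := hlapr 0
    have h2 : (N : ℝ) * (N * (r + s - (1 + 1))) ≤ K ^ 2 := by
      have e : r + s - (1 + 1) = (r - 1) * (1 - s) := by
        have : (r - 1) * (1 - s) = r + s - 1 - r * s := by ring
        rw [this, hrs]; ring
      rw [e, hds]
      have : (N : ℝ) * (N * ((r - 1) * ((r - 1) * s))) = K ^ 2 * s := by rw [← hNd]; ring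
      rw [this]
      exact mul_le_of_le_one_right (by positivity) hs1
    have h3 : 0 ≤ α * E * N * (1 + 1) := by positivity
    have h4 : 0 ≤ K ^ 2 := by positivity
    linarith
  · obtain ⟨l, rfl⟩ := Nat.exists_eq_add_of_le' h0
    by_cases h1 : l + 1 + 1 = N
    · have hc : 0 ≤ K ^ 2 * (r ^ (l + 1) + s ^ (l + 1)) := by positivity
      refine le_trans ?_ hc
      have hN1 : N - 1 = l + 1 := by omega
      unfold Omega gradMinus
      simp only [h1, hN1, if_true, Nat.add_sub_cancel]
      rw [if_neg (by omega)]
      have hl : 1 + K / 3 ≤ r ^ l := by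
        have h2 := one_add_mul_le_pow (a := r - 1) (by linarith) l
        have h3 : (1 : ℝ) / 3 * N ≤ l := by
          have : (N : ℝ) = l + 2 := by rw [← h1]; push_cast; ring
          have h4 : (3 : ℝ) ≤ N := by exact_mod_cast hN
          linarith
        have h5 : (1 : ℝ) / 3 * N * (r - 1) ≤ l * (r - 1) :=
          mul_le_mul_of_nonneg_right h3 (by linarith)
        have h6 : (1 : ℝ) / 3 * N * (r - 1) = K / 3 := by rw [mul_assoc, hNd]; ring
        have h7 : (1 + (r - 1)) ^ l = r ^ l := by ring
        linarith
      have hmain : E * (r ^ (l + 1) + s ^ (l + 1)) ≤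
          N * ((r ^ (l + 1) + s ^ (l + 1)) - (r ^ l + s ^ l)) := by
        have e : N * ((r ^ (l + 1) + s ^ (l + 1)) - (r ^ l + s ^ l))
            = K * (r ^ l - s ^ (l + 1)) := by
          have : (r ^ (l + 1) + s ^ (l + 1)) - (r ^ l + s ^ l)
              = (r - 1) * r ^ l - s ^ l * (1 - s) := by ring
          rw [this, hds, ← hNd]; ring
        rw [e]
        have h5 := (hpow (l + 1)).1
        have h6 : r ^ (l + 1) ≤ r ^ l * (3 / 2) := by
          rw [pow_succ]; exact mul_le_mul_of_nonneg_left hrle (by positivity)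
        nlinarith
      have hq : (1 : ℝ) ≤ 1 + E / N := by simp; positivity
      have hge := hmono l
      have h8 : N * ((r ^ (l + 1) + s ^ (l + 1)) - (r ^ l + s ^ l)) ≤
          N * (1 + E / N) * ((r ^ (l + 1) + s ^ (l + 1)) - (r ^ l + s ^ l)) :=
        mul_le_mul_of_nonneg_right (le_mul_of_one_le_right hNpos.le hq) hge
      have h9 : β * E * (r ^ (l + 1) + s ^ (l + 1)) ≤ E * (r ^ (l + 1) + s ^ (l + 1)) := by
        have : 0 ≤ E * (r ^ (l + 1) + s ^ (l + 1)) := by positivity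
        rw [mul_assoc]
        exact mul_le_of_le_one_left this hβ
      have h10 := mul_le_mul_of_nonneg_left (h9.trans (hmain.trans h8)) hNpos.le
      linarith
    · unfold Omega lap gradMinus
      rw [if_neg (by omega), if_neg (by omega)]
      simp only [Nat.add_sub_cancel]
      have h2 := hlapr l
      have h3 := hlaps l
      have h4 := mul_nonneg (mul_nonneg hE.le hNpos.le) (hmono l)
      have e1 : l + 1 + 1 = l + 2 := rfl
      rw [e1]
      linarith

theorem sum_kernel_le (hE : 0 < E) (hα : 0 ≤ α) (hβ : β ≤ 1) (hN : 3 ≤ N)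
    (hN' : 6 * E + 6 ≤ N) {t : ℝ} (ht : 0 ≤ t) (a : Fin N) :
    ∑ k, kernel α β E N t a k
      ≤ Real.exp ((3 * E + 3) ^ 2 * t) * (Real.exp (3 * E + 3) + 1) := by
  set c := (3 * E + 3) ^ 2 with hc
  set r : ℝ := 1 + (3 * E + 3) / N with hr
  have hr1 : 1 ≤ r := by rw [hr]; simp; positivity
  set f : ℕ → ℝ := fun k => r ^ k + (r⁻¹) ^ k with hf
  have hf1 : ∀ k, 1 ≤ f k := fun k => by
    have h1 : 1 ≤ r ^ k := one_le_pow₀ hr1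
    have h2 : 0 ≤ (r⁻¹) ^ k := by positivity
    simp only [hf]; linarith
  -- by the supersolution property `e^{-cs} e^{sΩ} f` is nonincreasing in `s`
  set g : ℝ → ℝ := fun s => Real.exp (-(c * s)) * ∑ k, kernel α β E N s a k * f k with hg
  have hgd : ∀ s, HasDerivAt g (Real.exp (-(c * s)) * (-(c * 1)) * ∑ k, kernel α β E N s a k * f k
      + Real.exp (-(c * s)) * ∑ k, (∑ l, kernel α β E N s a l * omegaMatrix α β E N l k) * f k) s :=
    fun s => (((hasDerivAt_id s).const_mul c).neg.exp).mul
      (HasDerivAt.fun_sum fun k _ => (hasDerivAt_kernel s a k).mul_const _)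
  have hanti : AntitoneOn g (Ici 0) := by
    refine antitoneOn_of_hasDerivWithinAt_nonpos (convex_Ici 0)
      (fun s hs => (hgd s).continuousAt.continuousWithinAt)
      (fun s hs => (hgd s).hasDerivWithinAt) fun s hs => ?_
    have hs' : 0 ≤ s := interior_subset hs
    have e : ∑ k, (∑ l, kernel α β E N s a l * omegaMatrix α β E N l k) * f k
        = ∑ l, kernel α β E N s a l * Omega α β E N f l := by
      simp only [Finset.sum_mul]
      rw [Finset.sum_comm]
      refine Finset.sum_congr rfl fun l _ => ?_
      rw [← sum_omegaMatrix_mul (by omega) f l, Finset.mul_sum]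
      exact Finset.sum_congr rfl fun k _ => by ring
    have h1 : ∑ l, kernel α β E N s a l * Omega α β E N f l
        ≤ c * ∑ k, kernel α β E N s a k * f k := by
      rw [Finset.mul_sum]
      refine Finset.sum_le_sum fun l _ => ?_
      have := mul_le_mul_of_nonneg_left (Omega_cosh_le hE hα hβ hN hN' l.2)
        (kernel_nonneg (α := α) (β := β) hE (by omega) hs' a l)
      calc _ ≤ _ := this
        _ = _ := by simp only [hf, hc, hr]; ring
    rw [e]
    have := mul_le_mul_of_nonneg_left h1 (Real.exp_pos (-(c * s))).le
    linarith
  have h := hanti (mem_Ici.2 (le_refl (0 : ℝ))) ht ht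
  simp only [hg, mul_zero, neg_zero, Real.exp_zero, one_mul, kernel_zero, Matrix.one_apply,
    ite_mul, zero_mul, Finset.sum_ite_eq, Finset.mem_univ, if_true] at h
  have hfa : f a ≤ Real.exp (3 * E + 3) + 1 := by
    have h1 : r ^ (a : ℕ) ≤ Real.exp (3 * E + 3) := pow_one_add_div_le_exp (by positivity) a.2.le
    have h2 : (r⁻¹) ^ (a : ℕ) ≤ 1 := pow_le_one₀ (by positivity) (inv_le_one_of_one_le₀ hr1)
    simp only [hf]; linarith
  calc ∑ k, kernel α β E N t a k ≤ ∑ k, kernel α β E N t a k * f k :=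
        Finset.sum_le_sum fun k _ =>
          le_mul_of_one_le_right (kernel_nonneg hE (by omega) ht a k) (hf1 k)
    _ = Real.exp (c * t) * (Real.exp (-(c * t)) * ∑ k, kernel α β E N t a k * f k) := by
        rw [← mul_assoc, ← Real.exp_add]; simp
    _ ≤ _ := mul_le_mul_of_nonneg_left (h.trans hfa) (Real.exp_pos _).le

/-! ### The Green function on the diagonal -/

/-- A discrete Sobolev inequality in dimension one. -/
theorem discrete_sobolev (hN : 1 ≤ N) (f : ℕ → ℝ) {j : ℕ} (hj : j < N) {ε : ℝ} (hε : 0 < ε) :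
    N * f j ^ 2 ≤ ε / 2 * ((N : ℝ) ^ 2 * ∑ i ∈ Finset.range (N - 1), (f (i + 1) - f i) ^ 2)
      + (1 + 2 / ε) * ∑ i ∈ Finset.range N, f i ^ 2 := by
  have hNpos : (0 : ℝ) < N := by positivity
  set D := ∑ i ∈ Finset.range (N - 1), (f (i + 1) - f i) ^ 2 with hD
  set F := ∑ i ∈ Finset.range N, f i ^ 2 with hF
  have hstep : ∀ i, dist (f i ^ 2) (f (i + 1) ^ 2)
      ≤ ε * N / 2 * (f (i + 1) - f i) ^ 2 + 1 / (ε * N) * (f (i + 1) ^ 2 + f i ^ 2) := by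
    intro i
    rw [Real.dist_eq]
    set w := ε * N with hw
    have hw0 : 0 < w := by positivity
    have e1 : 1 / w * (f (i + 1) ^ 2 + f i ^ 2) =
        1 / (2 * w) * (f (i + 1) + f i) ^ 2 + 1 / (2 * w) * (f (i + 1) - f i) ^ 2 := by
      field_simp; ring
    have e2 : 0 ≤ 1 / (2 * w) * (f (i + 1) - f i) ^ 2 := by positivity
    have key : ∀ a b : ℝ, a * b ≤ w / 2 * a ^ 2 + 1 / (2 * w) * b ^ 2 := by
      intro a b
      have : w / 2 * a ^ 2 + 1 / (2 * w) * b ^ 2 - a * b = 1 / (2 * w) * (w * a - b) ^ 2 := by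
        field_simp; ring
      have h2 : 0 ≤ 1 / (2 * w) * (w * a - b) ^ 2 := by positivity
      linarith
    rw [abs_le]
    have k1 := key (f (i + 1) - f i) (f (i + 1) + f i)
    have k2 := key (f (i + 1) - f i) (-(f (i + 1) + f i))
    rw [neg_sq] at k2
    constructor <;> nlinarith
  have hsum : ∑ i ∈ Finset.range (N - 1), dist (f i ^ 2) (f (i + 1) ^ 2)
      ≤ ε * N / 2 * D + 2 / (ε * N) * F := by
    refine (Finset.sum_le_sum fun i _ => hstep i).trans ?_
    rw [Finset.sum_add_distrib, ← Finset.mul_sum, ← Finset.mul_sum, Finset.sum_add_distrib]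
    obtain ⟨M, rfl⟩ := Nat.exists_eq_add_of_le' hN
    have h1 : ∑ i ∈ Finset.range M, f (i + 1) ^ 2 ≤ F := by
      rw [hF, Finset.sum_range_succ']; nlinarith [sq_nonneg (f 0)]
    have h2 : ∑ i ∈ Finset.range M, f i ^ 2 ≤ F := by
      rw [hF, Finset.sum_range_succ]; nlinarith [sq_nonneg (f M)]
    have h3 : 2 / (ε * ((M + 1 : ℕ) : ℝ)) * F = 1 / (ε * ((M + 1 : ℕ) : ℝ)) * (F + F) := by ring
    rw [h3, hD, Nat.add_sub_cancel]
    gcongr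
  have hpair : ∀ k ∈ Finset.range N, f j ^ 2 ≤ f k ^ 2 + (ε * N / 2 * D + 2 / (ε * N) * F) := by
    intro k hk
    rw [Finset.mem_range] at hk
    have gen : ∀ m n : ℕ, m ≤ n → n < N → dist (f m ^ 2) (f n ^ 2)
        ≤ ∑ i ∈ Finset.range (N - 1), dist (f i ^ 2) (f (i + 1) ^ 2) := fun m n hmn hn =>
      (dist_le_Ico_sum_dist (fun i => f i ^ 2) hmn).trans
        (Finset.sum_le_sum_of_subset_of_nonneg
          (fun i hi => by simp only [Finset.mem_Ico, Finset.mem_range] at *; omega)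
          fun _ _ _ => dist_nonneg)
    have h1 : dist (f j ^ 2) (f k ^ 2) ≤ ε * N / 2 * D + 2 / (ε * N) * F := by
      rcases le_total j k with h | h
      · exact (gen j k h hk).trans hsum
      · rw [dist_comm]; exact (gen k j h hj).trans hsum
    have h2 := le_abs_self (f j ^ 2 - f k ^ 2)
    rw [Real.dist_eq] at h1
    linarith
  have h := Finset.sum_le_sum hpair
  simp only [Finset.sum_const, Finset.card_range, nsmul_eq_mul, Finset.sum_add_distrib] at h
  rw [← hF] at h
  refine h.trans (le_of_eq ?_)
  field_simp
  ring

/-- Summation by parts for the Dirichlet form of `Ω` in the reversible weights. -/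
theorem sum_mul_Omega_le (hE : 0 < E) (hα : 0 ≤ α) (hN : 2 ≤ N) (f : ℕ → ℝ) :
    ∑ i ∈ Finset.range N, ((1 + E / N) ^ i)⁻¹ * f i * Omega α β E N f i
      ≤ -((N : ℝ) ^ 2 * ∑ i ∈ Finset.range (N - 1), ((1 + E / N) ^ i)⁻¹ * (f (i + 1) - f i) ^ 2)
        + β * E * N * ((1 + E / N) ^ (N - 1))⁻¹ * f (N - 1) ^ 2 := by
  obtain ⟨M, rfl⟩ : ∃ M, N = M + 1 := ⟨N - 1, by omega⟩
  set n : ℝ := ((M + 1 : ℕ) : ℝ) with hn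
  have hn0 : 0 ≤ n := by positivity
  set q := 1 + E / n with hq
  have hq0 : 0 < q := by positivity
  have e : ∀ i ∈ Finset.range (M + 1), (q ^ i)⁻¹ * f i * Omega α β E (M + 1) f i =
      (q ^ i)⁻¹ * f i * (if i + 1 < M + 1 then n ^ 2 * (f (i + 1) - f i) else 0)
      - (q ^ i)⁻¹ * f i * (if 0 < i then n ^ 2 * q * (f i - f (i - 1)) else 0)
      + (q ^ i)⁻¹ * f i * (if i = 0 then -(α * E * n * f i) else 0)
      + (q ^ i)⁻¹ * f i * (if i + 1 = M + 1 then β * E * n * f i else 0) := by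
    intro i hi
    rw [Omega_eq hN f (Finset.mem_range.1 hi)]
    ring
  rw [Finset.sum_congr rfl e, Finset.sum_add_distrib, Finset.sum_add_distrib,
    Finset.sum_sub_distrib]
  have s1 : ∑ i ∈ Finset.range (M + 1),
      (q ^ i)⁻¹ * f i * (if i + 1 < M + 1 then n ^ 2 * (f (i + 1) - f i) else 0)
      = ∑ i ∈ Finset.range M, (q ^ i)⁻¹ * f i * (n ^ 2 * (f (i + 1) - f i)) := by
    rw [Finset.sum_range_succ]
    simp only [lt_irrefl, if_false, mul_zero, add_zero]
    refine Finset.sum_congr rfl fun i hi => ?_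
    rw [if_pos (by have := Finset.mem_range.1 hi; omega)]
  have s2 : ∑ i ∈ Finset.range (M + 1),
      (q ^ i)⁻¹ * f i * (if 0 < i then n ^ 2 * q * (f i - f (i - 1)) else 0)
      = ∑ i ∈ Finset.range M, (q ^ i)⁻¹ * f (i + 1) * (n ^ 2 * (f (i + 1) - f i)) := by
    rw [Finset.sum_range_succ']
    simp only [lt_irrefl, if_false, mul_zero, add_zero]
    refine Finset.sum_congr rfl fun i hi => ?_
    rw [if_pos (by omega), Nat.add_sub_cancel, pow_succ]
    field_simp
  have s3 : ∑ i ∈ Finset.range (M + 1),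
      (q ^ i)⁻¹ * f i * (if i = 0 then -(α * E * n * f i) else 0) = -(α * E * n * f 0 ^ 2) := by
    rw [Finset.sum_eq_single 0]
    · simp; ring
    · intro b _ hb; simp [hb]
    · simp
  have s4 : ∑ i ∈ Finset.range (M + 1),
      (q ^ i)⁻¹ * f i * (if i + 1 = M + 1 then β * E * n * f i else 0)
      = β * E * n * (q ^ M)⁻¹ * f M ^ 2 := by
    rw [Finset.sum_eq_single M]
    · simp; ring
    · intro b _ hb; simp [hb]
    · simp
  rw [s1, s2, s3, s4, ← Finset.sum_sub_distrib, Nat.add_sub_cancel, Finset.mul_sum,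
    ← Finset.sum_neg_distrib]
  have h0 : 0 ≤ α * E * n * f 0 ^ 2 := by positivity
  have s5 : ∑ i ∈ Finset.range M, ((q ^ i)⁻¹ * f i * (n ^ 2 * (f (i + 1) - f i))
      - (q ^ i)⁻¹ * f (i + 1) * (n ^ 2 * (f (i + 1) - f i)))
      = ∑ i ∈ Finset.range M, -(n ^ 2 * ((q ^ i)⁻¹ * (f (i + 1) - f i) ^ 2)) :=
    Finset.sum_congr rfl fun i _ => by ring
  rw [s5]
  linarith

/-- A constant shift making `-Ω` coercive, uniformly in `N`, `α` and `β`. -/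
noncomputable def shift (E : ℝ) : ℝ := 1 + E * (1 + 2 * E / Real.exp (-E)) / Real.exp (-E)

theorem shift_pos (hE : 0 < E) : 0 < shift E := by unfold shift; positivity

/-- Coercivity of the Dirichlet form: the boundary creation term is absorbed by the discrete
Sobolev inequality. -/
theorem coercivity (hE : 0 < E) (hα : 0 ≤ α) (hβ : β ≤ 1) (hN : 2 ≤ N) (f : ℕ → ℝ)
    {j : ℕ} (hj : j < N) :
    Real.exp (-E) / 2 * (N * f j ^ 2) ≤
      ∑ i ∈ Finset.range N, ((1 + E / N) ^ i)⁻¹ * f i * (shift E * f i - Omega α β E N f i) := by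
  set m := Real.exp (-E) with hm
  have hm0 : 0 < m := Real.exp_pos _
  set D := ∑ i ∈ Finset.range (N - 1), (f (i + 1) - f i) ^ 2 with hD
  set F := ∑ i ∈ Finset.range N, f i ^ 2 with hF
  have h1 := sum_mul_Omega_le (β := β) hE hα hN f
  have h2 := discrete_sobolev (by omega) f hj (ε := 2) two_pos
  -- with `ε = m / E` the boundary term takes half of the Dirichlet form
  have h3 := discrete_sobolev (by omega) f (show N - 1 < N by omega) (ε := m / E) (by positivity)
  rw [← hD, ← hF] at h2 h3
  have hNpos : (0 : ℝ) < N := by positivity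
  have hDn : m * D ≤ ∑ i ∈ Finset.range (N - 1), ((1 + E / N) ^ i)⁻¹ * (f (i + 1) - f i) ^ 2 := by
    rw [hD, Finset.mul_sum]
    refine Finset.sum_le_sum fun i hi => mul_le_mul_of_nonneg_right
      (exp_neg_le_inv_pow hE ?_) (sq_nonneg _)
    have := Finset.mem_range.1 hi; omega
  have hFn : m * F ≤ ∑ i ∈ Finset.range N, ((1 + E / N) ^ i)⁻¹ * f i ^ 2 := by
    rw [hF, Finset.mul_sum]
    refine Finset.sum_le_sum fun i hi => mul_le_mul_of_nonneg_right
      (exp_neg_le_inv_pow hE ?_) (sq_nonneg _)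
    have := Finset.mem_range.1 hi; omega
  have hq : (1 : ℝ) ≤ 1 + E / N := by simp; positivity
  have hb : β * E * N * ((1 + E / N) ^ (N - 1))⁻¹ * f (N - 1) ^ 2 ≤ E * (N * f (N - 1) ^ 2) := by
    have h5 : ((1 + E / N) ^ (N - 1))⁻¹ ≤ 1 := inv_le_one_of_one_le₀ (one_le_pow₀ hq)
    have h6 : β * ((1 + E / N) ^ (N - 1))⁻¹ ≤ 1 * 1 := mul_le_mul hβ h5 (by positivity) zero_le_one
    have h7 : 0 ≤ E * (N * f (N - 1) ^ 2) := by positivity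
    have := mul_le_mul_of_nonneg_right h6 h7
    linarith
  have hb2 : E * (N * f (N - 1) ^ 2) ≤ m / 2 * ((N : ℝ) ^ 2 * D) + E * (1 + 2 * E / m) * F := by
    refine (mul_le_mul_of_nonneg_left h3 hE.le).trans (le_of_eq ?_)
    field_simp
  have hs : shift E * m = m + E * (1 + 2 * E / m) := by
    unfold shift; rw [← hm]; field_simp
  have hsF : shift E * (m * F) ≤
      shift E * ∑ i ∈ Finset.range N, ((1 + E / N) ^ i)⁻¹ * f i ^ 2 :=
    mul_le_mul_of_nonneg_left hFn (shift_pos hE).le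
  have hsF2 : shift E * (m * F) = m * F + E * (1 + 2 * E / m) * F := by
    rw [← mul_assoc, hs]; ring
  have hDN := mul_le_mul_of_nonneg_left hDn (sq_nonneg (N : ℝ))
  have e : ∑ i ∈ Finset.range N, ((1 + E / N) ^ i)⁻¹ * f i * (shift E * f i - Omega α β E N f i)
      = shift E * (∑ i ∈ Finset.range N, ((1 + E / N) ^ i)⁻¹ * f i ^ 2)
        - ∑ i ∈ Finset.range N, ((1 + E / N) ^ i)⁻¹ * f i * Omega α β E N f i := by
    rw [Finset.mul_sum, ← Finset.sum_sub_distrib]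
    exact Finset.sum_congr rfl fun i _ => by ring
  rw [e]
  have h8 := mul_le_mul_of_nonneg_left h2 (show 0 ≤ m / 2 by positivity)
  linarith

/-- The diagonal of the (killed, time-doubled) Green function is of order `1 / N`. -/
theorem integral_kernel_diag_le (hE : 0 < E) (hα : 0 ≤ α) (hβ : β ≤ 1) (hN : 2 ≤ N)
    {t : ℝ} (ht : 0 ≤ t) (a : Fin N) :
    ∫ s in (0 : ℝ)..t, Real.exp (-(2 * shift E * s)) * kernel α β E N (s + s) a a
      ≤ 2 / (Real.exp (-E) * N) := by
  set c := shift E with hc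
  have hNpos : (0 : ℝ) < N := by positivity
  set w : Fin N → ℝ → ℝ := fun k s => Real.exp (-(2 * c * s)) * kernel α β E N (s + s) k a with hw
  set A : Fin N → ℝ := fun k => ∫ s in (0 : ℝ)..t, w k s with hA
  have hwc : ∀ k, Continuous (w k) := fun k =>
    (by fun_prop : Continuous fun s : ℝ => Real.exp (-(2 * c * s))).mul
      ((continuous_kernel k a).comp (continuous_id.add continuous_id))
  have hw0 : ∀ k, ∀ s ∈ Icc 0 t, 0 ≤ w k s := fun k s hs =>
    mul_nonneg (Real.exp_pos _).le (kernel_nonneg hE hN (add_nonneg hs.1 hs.1) k a)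
  have hA0 : ∀ k, 0 ≤ A k := fun k => intervalIntegral.integral_nonneg ht (hw0 k)
  set f : ℕ → ℝ := fun k => if h : k < N then A ⟨k, h⟩ else 0 with hf
  have hfA : ∀ k : Fin N, f k = A k := fun k => by simp [hf]
  -- `A` solves the resolvent equation up to a nonnegative remainder
  have hwd : ∀ k s, HasDerivAt (w k)
      (2 * ((∑ l, omegaMatrix α β E N k l * w l s) - c * w k s)) s := by
    intro k s
    have h1 : HasDerivAt (fun s : ℝ => Real.exp (-(2 * c * s)))
        (Real.exp (-(2 * c * s)) * (-(2 * c * 1))) s :=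
      ((hasDerivAt_id s).const_mul (2 * c)).neg.exp
    have h2 : HasDerivAt (fun s : ℝ => kernel α β E N (s + s) k a)
        ((∑ l, omegaMatrix α β E N k l * kernel α β E N (s + s) l a) * (1 + 1)) s :=
      HasDerivAt.comp s (h₂ := fun r => kernel α β E N r k a) (h := fun s => s + s)
        (hasDerivAt_exp_entry' (omegaMatrix α β E N) (s + s) k a)
        ((hasDerivAt_id' s).fun_add (hasDerivAt_id' s))
    refine (h1.mul h2).congr_deriv ?_
    simp only [hw, Finset.sum_mul, Finset.mul_sum, mul_sub]
    rw [add_comm]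
    have : ∀ x y : ℝ, x + y = x - -y := fun x y => by ring
    rw [this]
    congr 1
    · exact Finset.sum_congr rfl fun l _ => by ring
    · ring
  have hres : ∀ k : Fin N, c * f k - Omega α β E N f k ≤ if k = a then 1 else 0 := by
    intro k
    have hint : ∫ s in (0 : ℝ)..t, 2 * ((∑ l, omegaMatrix α β E N k l * w l s) - c * w k s)
        = w k t - w k 0 := by
      refine intervalIntegral.integral_eq_sub_of_hasDerivAt (fun s _ => hwd k s)
        (Continuous.intervalIntegrable ?_ _ _)
      exact continuous_const.mul ((continuous_finsetSum _ fun l _ =>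
        continuous_const.mul (hwc l)).sub (continuous_const.mul (hwc k)))
    have hlin : ∫ s in (0 : ℝ)..t, 2 * ((∑ l, omegaMatrix α β E N k l * w l s) - c * w k s)
        = 2 * (Omega α β E N f k - c * f k) := by
      rw [intervalIntegral.integral_const_mul, intervalIntegral.integral_sub,
        intervalIntegral.integral_finsetSum, intervalIntegral.integral_const_mul, hfA,
        ← sum_omegaMatrix_mul hN f k]
      · simp only [intervalIntegral.integral_const_mul, hfA, hA]
      · exact fun l _ => (continuous_const.mul (hwc l)).intervalIntegrable _ _
      · exact (continuous_finsetSum _ fun l _ =>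
          continuous_const.mul (hwc l)).intervalIntegrable _ _
      · exact (continuous_const.mul (hwc k)).intervalIntegrable _ _
    have h0 : w k 0 = if k = a then 1 else 0 := by
      simp [hw, kernel_zero, Matrix.one_apply]
    have h1 := hw0 k t (right_mem_Icc.2 ht)
    have h2 : w k 0 ≤ 1 ∧ 0 ≤ w k 0 := by rw [h0]; split_ifs <;> norm_num
    rw [← h0]
    linarith [hint.symm.trans hlin]
  have hco := coercivity (β := β) hE hα hβ hN f a.2
  have hq : (1 : ℝ) ≤ 1 + E / N := by simp; positivity
  have hup : ∑ i ∈ Finset.range N, ((1 + E / N) ^ i)⁻¹ * f i * (c * f i - Omega α β E N f i)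
      ≤ A a := by
    rw [Finset.sum_range]
    calc _ ≤ ∑ i : Fin N, ((1 + E / N) ^ (i : ℕ))⁻¹ * f i * (if i = a then 1 else 0) := by
          refine Finset.sum_le_sum fun i _ => mul_le_mul_of_nonneg_left (hres i) ?_
          rw [hfA]; exact mul_nonneg (by positivity) (hA0 i)
      _ = ((1 + E / N) ^ (a : ℕ))⁻¹ * A a := by simp [hfA]
      _ ≤ 1 * A a := mul_le_mul_of_nonneg_right
          (inv_le_one_of_one_le₀ (one_le_pow₀ hq)) (hA0 a)
      _ = A a := one_mul _
  have h := hco.trans hup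
  rw [hfA] at h
  change A a ≤ _
  rw [le_div_iff₀ (by positivity)]
  rcases (hA0 a).eq_or_lt with h0 | h0
  · rw [← h0]; norm_num
  · by_contra! hcon
    have : A a < Real.exp (-E) / 2 * (N * A a ^ 2) := by
      have h3 := mul_lt_mul_of_pos_right hcon h0
      nlinarith
    linarith

/-- The space-time `L²` norm of the kernel started from a point is of order `N ^ (-1/2)`. -/
theorem integral_sum_kernel_sq_le (hE : 0 < E) (hα : 0 ≤ α) (hβ : β ≤ 1)
    (hN : 2 ≤ N) {t : ℝ} (ht : 0 ≤ t) (a : Fin N) :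
    ∫ s in (0 : ℝ)..t, ∑ k, kernel α β E N (t - s) a k ^ 2
      ≤ 2 * Real.exp (2 * E + 2 * shift E * t) / N := by
  have hc := shift_pos hE
  have hNpos : (0 : ℝ) < N := by positivity
  have hrev : ∫ s in (0 : ℝ)..t, ∑ k, kernel α β E N (t - s) a k ^ 2
      = ∫ s in (0 : ℝ)..t, ∑ k, kernel α β E N s a k ^ 2 := by
    have := intervalIntegral.integral_comp_sub_left (a := 0) (b := t)
      (fun s => ∑ k, kernel α β E N s a k ^ 2) t
    simpa using this
  have hcont : Continuous fun s => kernel α β E N (s + s) a a :=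
    (continuous_kernel a a).comp (continuous_id.add continuous_id)
  rw [hrev]
  have hpt : ∀ s ∈ Icc 0 t, ∑ k, kernel α β E N s a k ^ 2 ≤ Real.exp (E + 2 * shift E * t) *
      (Real.exp (-(2 * shift E * s)) * kernel α β E N (s + s) a a) := by
    intro s hs
    refine (sum_kernel_sq_le hE hN hs.1 a).trans ?_
    have h1 : Real.exp E ≤ Real.exp (E + 2 * shift E * t) * Real.exp (-(2 * shift E * s)) := by
      rw [← Real.exp_add]
      refine Real.exp_le_exp.2 ?_
      have := mul_le_mul_of_nonneg_left hs.2 hc.le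
      linarith
    rw [← mul_assoc]
    exact mul_le_mul_of_nonneg_right h1 (kernel_nonneg hE hN (add_nonneg hs.1 hs.1) a a)
  calc _ ≤ ∫ s in (0 : ℝ)..t, Real.exp (E + 2 * shift E * t) *
        (Real.exp (-(2 * shift E * s)) * kernel α β E N (s + s) a a) := by
        refine intervalIntegral.integral_mono_on ht (Continuous.intervalIntegrable ?_ _ _)
          (Continuous.intervalIntegrable ?_ _ _) hpt
        · exact continuous_finsetSum _ fun k _ => (continuous_kernel a k).pow 2
        · exact continuous_const.mul ((by fun_prop : Continuous fun s : ℝ =>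
            Real.exp (-(2 * shift E * s))).mul hcont)
    _ ≤ Real.exp (E + 2 * shift E * t) * (2 / (Real.exp (-E) * N)) := by
        rw [intervalIntegral.integral_const_mul]
        exact mul_le_mul_of_nonneg_left (integral_kernel_diag_le hE hα hβ hN ht a)
          (Real.exp_pos _).le
    _ = _ := by
        rw [Real.exp_neg, show 2 * E + 2 * shift E * t = E + (E + 2 * shift E * t) by ring,
          Real.exp_add E (E + _)]
        field_simp

end WASEP

/-! ### Bond moves, heights and the Cole-Hopf identity -/

namespace WASEP

variable {α β E : ℝ} {N : ℕ}

/-- The occupation variable of the site `l` as a real number, `0` off `{1, …, N - 1}`. -/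
noncomputable def siteVal (η : Config N) (l : ℕ) : ℝ := if site η l = true then 1 else 0

/-- The number of particles in `{1, …, k}`. -/
noncomputable def height (η : Config N) (k : ℕ) : ℝ := ∑ l ∈ Finset.Icc 1 k, siteVal η l

/-- The signed displacement of the move `σ^{i,i+1}`: `1` if it moves a particle from `i` to `i + 1`,
`-1` if it moves one from `i + 1` to `i`, `0` if it does nothing. -/
noncomputable def dir (i : ℕ) (η : Config N) : ℝ :=
  if i = 0 then 1 - 2 * siteVal η 1
  else if i + 1 = N then 2 * siteVal η (N - 1) - 1 else siteVal η i - siteVal η (i + 1)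

open Classical in
/-- The contribution of a transition `ζ → ζ'` to the current through the bond `{j, j + 1}`. -/
noncomputable def signedJump (j : ℕ) (ζ ζ' : Config N) : ℝ :=
  (if IsRightJump j ζ ζ' then 1 else 0) - (if IsLeftJump j ζ ζ' then 1 else 0)

theorem siteVal_eq_zero_or_one (η : Config N) (l : ℕ) : siteVal η l = 0 ∨ siteVal η l = 1 := by
  unfold siteVal; split_ifs <;> simp

theorem siteVal_le_one (η : Config N) (l : ℕ) : siteVal η l ≤ 1 := by
  rcases siteVal_eq_zero_or_one η l with h | h <;> simp [h]

theorem height_le (η : Config N) (k : ℕ) : height η k ≤ k := by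
  refine (Finset.sum_le_sum fun l _ => siteVal_le_one η l).trans ?_
  simp

theorem height_zero (η : Config N) : height η 0 = 0 := by simp [height]

theorem height_succ (η : Config N) (k : ℕ) : height η (k + 1) = height η k + siteVal η (k + 1) := by
  unfold height; rw [Finset.sum_Icc_succ_top (by omega)]

theorem dir_mem (i : ℕ) (η : Config N) : dir i η = 1 ∨ dir i η = -1 ∨ dir i η = 0 := by
  unfold dir
  rcases siteVal_eq_zero_or_one η 1 with h1 | h1 <;>
  rcases siteVal_eq_zero_or_one η (N - 1) with h2 | h2 <;>
  rcases siteVal_eq_zero_or_one η i with h3 | h3 <;>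
  rcases siteVal_eq_zero_or_one η (i + 1) with h4 | h4 <;>
  simp only [h1, h2, h3, h4] <;> split_ifs <;> norm_num

theorem site_of_mem {η : Config N} {l : ℕ} (h : l ∈ Finset.Icc 1 (N - 1)) : site η l = η ⟨l, h⟩ :=
  dif_pos h

theorem siteVal_bondMove (hN : 3 ≤ N) {i : ℕ} (hi : i < N) (η : Config N) {l : ℕ} (hl : 1 ≤ l)
    (hl' : l < N) : siteVal (bondMove i η) l
      = siteVal η l + dir i η * ((if l = i + 1 then 1 else 0) - (if l = i then 1 else 0)) := by
  have hm : l ∈ Finset.Icc 1 (N - 1) := Finset.mem_Icc.2 ⟨hl, by omega⟩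
  have hs : site (bondMove i η) l = bondMove i η ⟨l, hm⟩ := site_of_mem hm
  have he : η ⟨l, hm⟩ = site η l := (site_of_mem hm).symm
  unfold siteVal
  rw [hs]
  unfold bondMove dir siteVal
  by_cases h0 : i = 0
  · subst h0
    have hl0 : l ≠ 0 := by omega
    simp only [if_true, WASEP.flip, hl0, if_false, zero_add, he]
    by_cases h1 : l = 1
    · subst h1; cases site η 1 <;> norm_num
    · simp [h1]
  · by_cases h1 : i + 1 = N
    · have hlN : l ≠ N := by omega
      have h2 : N ≠ 1 := by omega
      simp only [h0, h1, if_false, if_true, WASEP.flip, he, hlN]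
      by_cases h3 : l = i
      · have h4 : N - 1 = i := by omega
        subst h3
        rw [h4]
        simp only [if_true]
        cases site η l <;> norm_num
      · have h4 : l ≠ N - 1 := by omega
        simp [h3, h4]
    · simp only [h0, h1, if_false, exchange, he]
      by_cases h3 : l = i
      · subst h3
        simp only [if_true, (show l ≠ l + 1 by omega), if_false]
        cases site η l <;> cases site η (l + 1) <;> norm_num
      · by_cases h4 : l = i + 1
        · subst h4
          simp only [h3, if_true, if_false]
          cases site η i <;> cases site η (i + 1) <;> norm_num
        · simp [h3, h4]

/-- The move across the bond `{i, i + 1}` changes only the height at `i`; a creation or annihilation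
at site `1` shifts all the heights but that at `0`. -/
theorem height_bondMove (hN : 3 ≤ N) {i : ℕ} (hi : i < N) (η : Config N) {k : ℕ} (hk : k < N) :
    height (bondMove i η) k
      = height η k + dir i η * ((if i = 0 then 1 else 0) - (if i = k then 1 else 0)) := by
  induction k with
  | zero =>
    rw [height_zero, height_zero]
    by_cases h : i = 0 <;> simp [h]
  | succ k ih =>
    rw [height_succ, height_succ, ih (by omega), siteVal_bondMove hN hi η (by omega) hk]
    have h1 : (k + 1 = i + 1) ↔ i = k := by omega
    have h2 : (k + 1 = i) ↔ i = k + 1 := by omega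
    simp only [h1, h2]
    ring

theorem IsRightJump.dir_eq (hN : 3 ≤ N) {j : ℕ} {ζ ζ' : Config N}
    (h : IsRightJump j ζ ζ') : dir j ζ = 1 := by
  obtain ⟨-, h1, h2⟩ := h
  unfold dir siteVal
  by_cases h0 : j = 0
  · subst h0
    have : site ζ 1 = false := h2.resolve_left (by omega)
    simp [this]
  · have h1 := h1.resolve_left h0
    by_cases h3 : j + 1 = N
    · have h4 : N - 1 = j := by omega
      simp only [h0, h3, h4, h1, if_true, if_false]; norm_num
    · have h2 := h2.resolve_left h3
      simp [h0, h3, h1, h2]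

theorem IsLeftJump.dir_eq (hN : 3 ≤ N) {j : ℕ} {ζ ζ' : Config N}
    (h : IsLeftJump j ζ ζ') : dir j ζ = -1 := by
  obtain ⟨-, h1, h2⟩ := h
  unfold dir siteVal
  by_cases h0 : j = 0
  · subst h0
    have : site ζ 1 = true := h1.resolve_left (by omega)
    simp only [zero_add, this, if_true]; norm_num
  · have h2 := h2.resolve_left h0
    by_cases h3 : j + 1 = N
    · have h4 : N - 1 = j := by omega
      simp only [h0, h3, h4, h2, if_true, if_false]; norm_num
    · have h1 := h1.resolve_left h3
      simp [h0, h3, h1, h2]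

theorem isRightJump_bondMove (hN : 3 ≤ N) {j : ℕ} {ζ : Config N} (h : dir j ζ = 1) :
    IsRightJump j ζ (bondMove j ζ) := by
  unfold dir siteVal at h
  refine ⟨rfl, ?_, ?_⟩
  · by_cases h0 : j = 0
    · exact Or.inl h0
    · refine Or.inr ?_
      by_cases h3 : j + 1 = N
      · have h4 : N - 1 = j := by omega
        rw [if_neg h0, if_pos h3, h4] at h
        cases hs : site ζ j
        · simp only [hs, Bool.false_eq_true, if_false] at h; norm_num at h
        · rfl
      · rw [if_neg h0, if_neg h3] at h
        cases hs : site ζ j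
        · simp only [hs, Bool.false_eq_true, if_false] at h; split_ifs at h <;> norm_num at h
        · rfl
  · by_cases h3 : j + 1 = N
    · exact Or.inl h3
    · refine Or.inr ?_
      by_cases h0 : j = 0
      · subst h0
        cases hs : site ζ (0 + 1)
        · rfl
        · rw [zero_add] at hs
          simp only [hs, if_true] at h; norm_num at h
      · rw [if_neg h0, if_neg h3] at h
        cases hs : site ζ (j + 1)
        · rfl
        · simp only [hs, if_true] at h; split_ifs at h <;> norm_num at h

theorem isLeftJump_bondMove (hN : 3 ≤ N) {j : ℕ} {ζ : Config N} (h : dir j ζ = -1) :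
    IsLeftJump j ζ (bondMove j ζ) := by
  unfold dir siteVal at h
  refine ⟨rfl, ?_, ?_⟩
  · by_cases h3 : j + 1 = N
    · exact Or.inl h3
    · refine Or.inr ?_
      by_cases h0 : j = 0
      · subst h0
        cases hs : site ζ (0 + 1)
        · rw [zero_add] at hs
          simp only [hs, Bool.false_eq_true, if_false, if_true] at h; norm_num at h
        · rfl
      · rw [if_neg h0, if_neg h3] at h
        cases hs : site ζ (j + 1)
        · simp only [hs, Bool.false_eq_true, if_false] at h; split_ifs at h <;> norm_num at h
        · rfl
  · by_cases h0 : j = 0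
    · exact Or.inl h0
    · refine Or.inr ?_
      by_cases h3 : j + 1 = N
      · have h4 : N - 1 = j := by omega
        rw [if_neg h0, if_pos h3, h4] at h
        cases hs : site ζ j
        · rfl
        · simp only [hs, if_true] at h; norm_num at h
      · rw [if_neg h0, if_neg h3] at h
        cases hs : site ζ j
        · rfl
        · simp only [hs, if_true] at h; split_ifs at h <;> norm_num at h

/-- Distinct bonds produce distinct transitions, as soon as one of them is a genuine jump. -/
theorem bondMove_ne (hN : 3 ≤ N) {i j : ℕ} (hi : i < N) (hj : j < N) (hij : i ≠ j) {ζ : Config N}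
    (hd : dir j ζ ≠ 0) : bondMove i ζ ≠ bondMove j ζ := by
  intro h
  have key : ∀ k < N, dir i ζ * ((if i = 0 then 1 else 0) - (if i = k then 1 else 0))
      = dir j ζ * ((if j = 0 then 1 else 0) - (if j = k then 1 else 0)) := by
    intro k hk
    have h1 := height_bondMove hN hi ζ hk
    have h2 := height_bondMove hN hj ζ hk
    rw [h] at h1
    linarith
  have hex : ∀ a : ℕ, ∃ k, k < N ∧ k ≠ 0 ∧ k ≠ a := fun a => by
    by_cases ha : a = 1
    · exact ⟨2, by omega, by omega, by omega⟩
    · exact ⟨1, by omega, by omega, fun e => ha e.symm⟩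
  by_cases hi0 : i = 0
  · subst hi0
    have hj0 : j ≠ 0 := fun e => hij e.symm
    obtain ⟨k, hk, hk0, hkj⟩ := hex j
    have h1 := key k hk
    have h2 := key j hj
    simp [hj0, hkj.symm, hk0.symm] at h1
    simp [hj0, hj0.symm, h1] at h2
    exact hd h2
  · by_cases hj0 : j = 0
    · subst hj0
      obtain ⟨k, hk, hk0, hki⟩ := hex i
      have h1 := key k hk
      simp [hi0, hki.symm, hk0.symm] at h1
      exact hd h1.symm
    · have h1 := key j hj
      simp [hi0, hj0, hij] at h1
      exact hd h1

theorem bondMove_ne_self (hN : 3 ≤ N) {j : ℕ} (hj : j < N) {ζ : Config N} (hd : dir j ζ ≠ 0) :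
    bondMove j ζ ≠ ζ := by
  intro h
  have key : ∀ k < N, dir j ζ * ((if j = 0 then 1 else 0) - (if j = k then 1 else 0)) = 0 := by
    intro k hk
    have h1 := height_bondMove hN hj ζ hk
    rw [h] at h1
    linarith
  by_cases hj0 : j = 0
  · have h1 := key 1 (by omega)
    simp [hj0] at h1
    exact hd (by rw [hj0]; exact h1)
  · have h1 := key j hj
    simp [hj0] at h1
    exact hd h1

theorem signedJump_self (hN : 3 ≤ N) {j : ℕ} (hj : j < N) (ζ : Config N) :
    signedJump j ζ ζ = 0 := by
  have h1 : ¬ IsRightJump j ζ ζ := fun h =>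
    bondMove_ne_self hN hj (by rw [h.dir_eq hN]; norm_num) h.1.symm
  have h2 : ¬ IsLeftJump j ζ ζ := fun h =>
    bondMove_ne_self hN hj (by rw [h.dir_eq hN]; norm_num) h.1.symm
  simp [signedJump, h1, h2]

theorem signedJump_bondMove (hN : 3 ≤ N) {i j : ℕ} (hi : i < N) (hj : j < N) (ζ : Config N) :
    signedJump j ζ (bondMove i ζ) = if i = j then dir i ζ else 0 := by
  by_cases hij : i = j
  · subst hij
    rw [if_pos rfl]
    unfold signedJump
    rcases dir_mem i ζ with h | h | h
    · have h1 := isRightJump_bondMove hN h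
      have h2 : ¬ IsLeftJump i ζ (bondMove i ζ) := fun h2 => by
        have := h2.dir_eq hN; rw [h] at this; norm_num at this
      simp [h1, h2, h]
    · have h1 := isLeftJump_bondMove hN h
      have h2 : ¬ IsRightJump i ζ (bondMove i ζ) := fun h2 => by
        have := h2.dir_eq hN; rw [h] at this; norm_num at this
      simp [h1, h2, h]
    · have h1 : ¬ IsLeftJump i ζ (bondMove i ζ) := fun h2 => by
        have := h2.dir_eq hN; rw [h] at this; norm_num at this
      have h2 : ¬ IsRightJump i ζ (bondMove i ζ) := fun h2 => by
        have := h2.dir_eq hN; rw [h] at this; norm_num at this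
      simp [h1, h2, h]
  · rw [if_neg hij]
    have h1 : ¬ IsRightJump j ζ (bondMove i ζ) := fun h =>
      bondMove_ne hN hi hj hij (by rw [h.dir_eq hN]; norm_num) h.1
    have h2 : ¬ IsLeftJump j ζ (bondMove i ζ) := fun h =>
      bondMove_ne hN hi hj hij (by rw [h.dir_eq hN]; norm_num) h.1
    simp [signedJump, h1, h2]

theorem occ_mem_Icc (hα : α ∈ Ioo (0 : ℝ) 1) (hβ : β ∈ Ioo (0 : ℝ) 1) (η : Config N) (k : ℕ) :
    occ α β η k ∈ Icc (0 : ℝ) 1 := by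
  have := hα.1.le; have := hα.2.le; have := hβ.1.le; have := hβ.2.le
  unfold occ
  split_ifs <;> constructor <;> linarith

theorem rate_nonneg (hE : 0 < E) (hα : α ∈ Ioo (0 : ℝ) 1) (hβ : β ∈ Ioo (0 : ℝ) 1) (i : ℕ)
    (η : Config N) : 0 ≤ rate α β E i η := by
  have h1 := occ_mem_Icc hα hβ η i
  have h2 := occ_mem_Icc hα hβ η (i + 1)
  have h3 : 0 ≤ 1 - occ α β η i := sub_nonneg.2 h1.2
  have h4 : 0 ≤ 1 - occ α β η (i + 1) := sub_nonneg.2 h2.2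
  have h5 := h1.1
  have h6 := h2.1
  unfold rate
  positivity

theorem rate_le (hE : 0 < E) (hN : 1 ≤ N) (hα : α ∈ Ioo (0 : ℝ) 1) (hβ : β ∈ Ioo (0 : ℝ) 1) (i : ℕ)
    (η : Config N) : rate α β E i η ≤ 1 + E := by
  obtain ⟨a1, a2⟩ := occ_mem_Icc hα hβ η i
  obtain ⟨b1, b2⟩ := occ_mem_Icc hα hβ η (i + 1)
  unfold rate
  set a := occ α β η i
  set b := occ α β η (i + 1)
  have hq : E / N ≤ E := div_le_self hE.le (by exact_mod_cast hN)
  have h1 : 0 ≤ a * (1 - b) := mul_nonneg a1 (by linarith)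
  have h2 : a * (1 - b) ≤ 1 := mul_le_one₀ a2 (by linarith) (by linarith)
  have h3 : (1 + E / N) * (a * (1 - b)) ≤ (1 + E) * (a * (1 - b)) :=
    mul_le_mul_of_nonneg_right (by linarith) h1
  have h4 : b * (1 - a) ≤ (1 + E) * (b * (1 - a)) :=
    le_mul_of_one_le_left (mul_nonneg b1 (by linarith)) (by linarith)
  have h5 : a * (1 - b) + b * (1 - a) ≤ 1 := by
    nlinarith [mul_nonneg (sub_nonneg.2 a2) (sub_nonneg.2 b2)]
  nlinarith

/-- The microscopic Cole-Hopf transform linearises the dynamics: the exponential of the height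
solves `∂_t = Ω` in mean. -/
theorem rate_mul_exp_height (hE : 0 < E) (hN : 3 ≤ N) {i : ℕ} (hi : i < N) (η : Config N)
    (x : ℝ) :
    (N : ℝ) ^ 2 * rate α β E i η * ((x * Real.exp (Real.log (1 + E / N) * height η i))
        * (Real.exp (-(Real.log (1 + E / N) * dir i η)) - 1))
      = Omega α β E N (fun k => x * Real.exp (Real.log (1 + E / N) * height η k)) i := by
  have hNpos : (0 : ℝ) < N := by positivity
  set q := 1 + E / (N : ℝ) with hq
  have hq0 : 0 < q := by positivity
  have hEq : E = N * (q - 1) := by rw [hq]; field_simp; ring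
  have e1 : Real.exp (Real.log q * 1) = q := by rw [mul_one, Real.exp_log hq0]
  have e2 : Real.exp (Real.log q * 0) = 1 := by simp
  have hsucc : ∀ k, Real.exp (Real.log q * height η (k + 1))
      = Real.exp (Real.log q * height η k) * Real.exp (Real.log q * siteVal η (k + 1)) := by
    intro k; rw [height_succ, mul_add, Real.exp_add]
  have n1 : Real.exp (-(Real.log q * 1)) = q⁻¹ := by rw [Real.exp_neg, e1]
  have n2 : Real.exp (-(Real.log q * 0)) = 1 := by simp
  have n3 : Real.exp (-(Real.log q * -1)) = q := by
    rw [mul_neg, neg_neg, e1]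
  rw [Omega_eq (by omega) _ hi]
  unfold rate occ
  simp only [← hq]
  by_cases h0 : i = 0
  · subst h0
    have a1 : 0 + 1 ≠ N := by omega
    have a2 : 0 + 1 < N := by omega
    have a3 : (0 : ℕ) ≠ N := by omega
    have a4 : (if site η (0 + 1) = true then (1 : ℝ) else 0) = siteVal η 1 := rfl
    have a5 : dir 0 η = 1 - 2 * siteVal η 1 := by simp [dir]
    simp only [a1, a2, a4, a5, if_true, if_false, lt_irrefl, hsucc, one_ne_zero, zero_add]
    rcases siteVal_eq_zero_or_one η 1 with h | h
    · simp only [h, mul_zero, sub_zero, n1, Real.exp_zero]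
      rw [hEq]; field_simp; ring
    · rw [h, show (1 : ℝ) - 2 * 1 = -1 by norm_num, n3, e1]
      rw [hEq]; ring
  · obtain ⟨l, rfl⟩ := Nat.exists_eq_succ_of_ne_zero h0
    simp only [Nat.succ_eq_add_one] at *
    have b1 : l + 1 ≠ N := by omega
    have b2 : (if site η (l + 1) = true then (1 : ℝ) else 0) = siteVal η (l + 1) := rfl
    by_cases h1 : l + 1 + 1 = N
    · have h2 : N - 1 = l + 1 := by omega
      have h3 : ¬ (N < N) := lt_irrefl N
      have h4 : N ≠ 0 := by omega
      have a5 : dir (l + 1) η = 2 * siteVal η (l + 1) - 1 := by simp [dir, h1, h2]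
      have h5 : ¬ l + 1 = 0 := by omega
      have h6 : 0 < l + 1 := by omega
      simp only [h1, h3, h4, h5, h6, a5, b1, b2, if_true, if_false, hsucc, Nat.add_sub_cancel]
      rcases siteVal_eq_zero_or_one η (l + 1) with h | h
      · rw [h, show (2 : ℝ) * 0 - 1 = -1 by norm_num, n3, e2]
        rw [hEq]; ring
      · rw [h, show (2 : ℝ) * 1 - 1 = 1 by norm_num, n1, e1]
        rw [hEq]; field_simp; ring
    · have h3 : l + 1 + 1 < N := by omega
      have h5 : ¬ l + 1 = 0 := by omega
      have h6 : 0 < l + 1 := by omega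
      have h7 : ¬ l + 1 + 1 = 0 := by omega
      have b3 : (if site η (l + 1 + 1) = true then (1 : ℝ) else 0) = siteVal η (l + 1 + 1) := rfl
      have a5 : dir (l + 1) η = siteVal η (l + 1) - siteVal η (l + 1 + 1) := by simp [dir, h1]
      simp only [h1, h3, h5, h6, h7, a5, b1, b2, b3, if_true, if_false, hsucc, Nat.add_sub_cancel]
      rcases siteVal_eq_zero_or_one η (l + 1) with h | h <;>
      rcases siteVal_eq_zero_or_one η (l + 1 + 1) with h' | h'
      · simp only [h, h', sub_zero, n2, e2]; ring
      · rw [h, h', show (0 : ℝ) - 1 = -1 by norm_num, n3, e2, e1]; ring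
      · rw [h, h', show (1 : ℝ) - 0 = 1 by norm_num, n1, e2, e1]; field_simp; ring
      · rw [h, h', sub_self, n2, e1]; ring

theorem abs_exp_dir_sub_one_le (hE : 0 < E) (hN : 1 ≤ N) (i : ℕ) (η : Config N) :
    |Real.exp (-(Real.log (1 + E / N) * dir i η)) - 1| ≤ E / N := by
  have hNpos : (0 : ℝ) < N := by positivity
  have hd : 0 < E / (N : ℝ) := by positivity
  have hq0 : 0 < 1 + E / (N : ℝ) := by positivity
  rcases dir_mem i η with h | h | h
  · rw [h, mul_one, Real.exp_neg, Real.exp_log hq0, abs_sub_comm, abs_of_nonneg]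
    · have : 1 - (1 + E / (N : ℝ))⁻¹ = E / N * (1 + E / (N : ℝ))⁻¹ := by field_simp; ring
      rw [this]
      exact mul_le_of_le_one_right hd.le (inv_le_one_of_one_le₀ (by linarith))
    · exact sub_nonneg.2 (inv_le_one_of_one_le₀ (by linarith))
  · rw [h, mul_neg, mul_one, neg_neg, Real.exp_log hq0]
    rw [show 1 + E / (N : ℝ) - 1 = E / N by ring, abs_of_pos hd]
  · rw [h]; simp; positivity

end WASEP

/-! ### Counting the jumps of a path along a fine partition -/

namespace WASEP

variable {α β E : ℝ} {N : ℕ}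

/-- The times in `(a, b]` at which the transition of the path `p` satisfies `R`. -/
def jumpTimes (R : Config N → Config N → Prop) (p : ℝ≥0 → Config N) (a b : ℝ≥0) : Set ℝ≥0 :=
  {s | s ∈ Ioc a b ∧ ∃ ζ, Tendsto p (𝓝[<] s) (𝓝 ζ) ∧ R ζ (p s)}

theorem nhdsLT_neBot_of_pos {r : ℝ≥0} (hr : 0 < r) : (𝓝[<] r).NeBot :=
  nhdsLT_neBot_of_exists_lt ⟨0, hr⟩

open Classical in
/-- Near any time `s` a right continuous path with left limits takes one value before `s` and one
value from `s` on, so that its increments between nearby times are its jumps. -/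
theorem eventually_jumpTimes {R : Config N → Config N → Prop} (hR : ∀ ζ, ¬ R ζ ζ)
    {p : ℝ≥0 → Config N} (hrc : ∀ t, ContinuousWithinAt p (Ici t) t)
    (hll : ∀ t, 0 < t → ∃ ζ, Tendsto p (𝓝[<] t) (𝓝 ζ)) (s : ℝ≥0) :
    ∃ U ∈ 𝓝 s, ∀ a ∈ U, ∀ b ∈ U, a ≤ b → (jumpTimes R p a b).Finite ∧
      (jumpTimes R p a b).ncard = if R (p a) (p b) then 1 else 0 := by
  have hright : ∀ᶠ r in 𝓝 s, s ≤ r → p r = p s := by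
    have h := (hrc s).eventually (show ∀ᶠ y in 𝓝 (p s), y = p s by simp)
    exact eventually_nhdsWithin_iff.1 h
  obtain ⟨ζ, hleft⟩ : ∃ ζ, ∀ᶠ r in 𝓝 s, r < s → p r = ζ := by
    rcases eq_or_lt_of_le (zero_le (a := s)) with h0 | h0
    · exact ⟨p 0, Eventually.of_forall fun r hr => absurd hr (by rw [← h0]; simp)⟩
    · obtain ⟨ζ, hζ⟩ := hll s h0
      exact ⟨ζ, eventually_nhdsWithin_iff.1
        (hζ.eventually (show ∀ᶠ y in 𝓝 ζ, y = ζ by simp))⟩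
  obtain ⟨ε, hε, hball⟩ := Metric.eventually_nhds_iff.1 (hright.and hleft)
  refine ⟨Metric.ball s ε, Metric.ball_mem_nhds s hε, fun a ha b hb hab => ?_⟩
  have hconv : ∀ r, a ≤ r → r ≤ b → dist r s < ε := by
    intro r har hrb
    rw [Metric.mem_ball, NNReal.dist_eq, abs_lt] at ha hb
    rw [NNReal.dist_eq, abs_lt]
    have h1 : (a : ℝ) ≤ r := har
    have h2 : (r : ℝ) ≤ b := hrb
    constructor <;> linarith [ha.1, hb.2]
  -- identification of the left limits in `(a, b]`
  have hlim : ∀ r, a < r → r ≤ b → ∀ ξ, Tendsto p (𝓝[<] r) (𝓝 ξ) →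
      (r ≠ s → ξ = p r) ∧ (r = s → ξ = ζ) := by
    intro r har hrb ξ hξ
    have : (𝓝[<] r).NeBot := nhdsLT_neBot_of_pos (pos_of_gt har)
    have huniq : ∀ y, (∀ᶠ x in 𝓝[<] r, p x = y) → ξ = y := fun y hy =>
      tendsto_nhds_unique hξ (tendsto_nhds_of_eventually_eq hy)
    have hlow : ∀ᶠ x in 𝓝[<] r, a < x ∧ x < r :=
      (eventually_nhdsWithin_of_eventually_nhds (lt_mem_nhds har)).and self_mem_nhdsWithin
    refine ⟨fun hrs => ?_, fun hrs => ?_⟩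
    · rcases lt_or_gt_of_ne hrs with h | h
      · rw [(hball (hconv r har.le hrb)).2 h]
        refine huniq ζ ?_
        filter_upwards [hlow] with x hx
        exact (hball (hconv x hx.1.le (hx.2.le.trans hrb))).2 (hx.2.trans h)
      · rw [(hball (hconv r har.le hrb)).1 h.le]
        refine huniq (p s) ?_
        filter_upwards [hlow, eventually_nhdsWithin_of_eventually_nhds (lt_mem_nhds h)] with x hx hx2
        exact (hball (hconv x hx.1.le (hx.2.le.trans hrb))).1 hx2.le
    · refine huniq ζ ?_
      filter_upwards [hlow] with x hx
      exact (hball (hconv x hx.1.le (hx.2.le.trans hrb))).2 (hrs ▸ hx.2)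
  by_cases hRab : R (p a) (p b)
  · have has : a < s := by
      by_contra! h
      have h1 := (hball (hconv a le_rfl hab)).1 h
      have h2 := (hball (hconv b hab le_rfl)).1 (h.trans hab)
      rw [h1, h2] at hRab
      exact hR _ hRab
    have hsb : s ≤ b := by
      by_contra! h
      have h1 := (hball (hconv a le_rfl hab)).2 has
      have h2 := (hball (hconv b hab le_rfl)).2 h
      rw [h1, h2] at hRab
      exact hR _ hRab
    have hpa := (hball (hconv a le_rfl hab)).2 has
    have hpb := (hball (hconv b hab le_rfl)).1 hsb
    have hset : jumpTimes R p a b = {s} := by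
      ext r
      simp only [jumpTimes, mem_ofPred_eq, mem_singleton_iff]
      constructor
      · rintro ⟨⟨h1, h2⟩, ξ, hξ, hRξ⟩
        by_contra hne
        rw [(hlim r h1 h2 ξ hξ).1 hne] at hRξ
        exact hR _ hRξ
      · rintro rfl
        obtain ⟨ξ, hξ⟩ := hll r (pos_of_gt has)
        refine ⟨⟨has, hsb⟩, ξ, hξ, ?_⟩
        rw [(hlim r has hsb ξ hξ).2 rfl, ← hpa, ← hpb]
        exact hRab
    rw [hset, if_pos hRab]
    simp
  · have hset : jumpTimes R p a b = ∅ := by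
      ext r
      simp only [jumpTimes, mem_ofPred_eq, mem_empty_iff_false, iff_false]
      rintro ⟨⟨h1, h2⟩, ξ, hξ, hRξ⟩
      by_cases hrs : r = s
      · subst hrs
        rw [(hlim r h1 h2 ξ hξ).2 rfl, ← (hball (hconv a le_rfl hab)).2 h1,
          ← (hball (hconv b hab le_rfl)).1 h2] at hRξ
        exact hRab hRξ
      · rw [(hlim r h1 h2 ξ hξ).1 hrs] at hRξ
        exact hR _ hRξ
    rw [hset, if_neg hRab]
    simp

/-- The partition points `t l / n` of `[0, t]`. -/
noncomputable def partPoint (t : ℝ≥0) (n l : ℕ) : ℝ≥0 := t * l / n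

theorem partPoint_mono (t : ℝ≥0) (n : ℕ) : Monotone (partPoint t n) := by
  intro a b hab
  unfold partPoint
  gcongr

theorem partPoint_zero (t : ℝ≥0) (n : ℕ) : partPoint t n 0 = 0 := by simp [partPoint]

theorem partPoint_self (t : ℝ≥0) {n : ℕ} (hn : 0 < n) : partPoint t n n = t := by
  unfold partPoint
  rw [mul_div_assoc, div_self, mul_one]
  exact_mod_cast hn.ne'

theorem coe_partPoint_succ_sub (t : ℝ≥0) (n l : ℕ) :
    (partPoint t n (l + 1) : ℝ) - partPoint t n l = t / n := by
  unfold partPoint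
  push_cast
  ring

open Classical in
theorem eventually_ncard_jumpTimes {R : Config N → Config N → Prop} (hR : ∀ ζ, ¬ R ζ ζ)
    {p : ℝ≥0 → Config N} (hrc : ∀ t, ContinuousWithinAt p (Ici t) t)
    (hll : ∀ t, 0 < t → ∃ ζ, Tendsto p (𝓝[<] t) (𝓝 ζ)) (t : ℝ≥0) :
    ∀ᶠ n : ℕ in atTop, ((jumpTimes R p 0 t).ncard : ℝ) = ∑ l ∈ Finset.range n,
      if R (p (partPoint t n l)) (p (partPoint t n (l + 1))) then 1 else 0 := by
  choose U hU hU2 using eventually_jumpTimes hR hrc hll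
  obtain ⟨δ, hδ, hleb⟩ := lebesgue_number_lemma_of_metric (s := Icc 0 t)
    (c := fun x => interior (U x)) isCompact_Icc (fun _ => isOpen_interior)
    fun x _ => mem_iUnion.2 ⟨x, mem_interior_iff_mem_nhds.2 (hU x)⟩
  have hsmall : ∀ᶠ n : ℕ in atTop, (t : ℝ) / n < δ :=
    (tendsto_const_div_atTop_nhds_zero_nat (t : ℝ)).eventually (gt_mem_nhds hδ)
  filter_upwards [hsmall, eventually_gt_atTop 0] with n hn hn0
  have key : ∀ i ≤ n, (jumpTimes R p 0 (partPoint t n i)).Finite ∧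
      ((jumpTimes R p 0 (partPoint t n i)).ncard : ℝ) = ∑ l ∈ Finset.range i,
        if R (p (partPoint t n l)) (p (partPoint t n (l + 1))) then 1 else 0 := by
    intro i
    induction i with
    | zero =>
      intro _
      have : jumpTimes R p 0 (partPoint t n 0) = ∅ := by
        rw [partPoint_zero]; simp [jumpTimes]
      rw [this]
      simp
    | succ i ih =>
      intro hi
      obtain ⟨h1, h2⟩ := ih (by omega)
      set a := partPoint t n i with ha
      set b := partPoint t n (i + 1) with hb
      have hab : a ≤ b := partPoint_mono t n (Nat.le_succ i)
      have hat : a ∈ Icc 0 t := ⟨zero_le, by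
        rw [← partPoint_self t hn0]; exact partPoint_mono t n (by omega)⟩
      obtain ⟨y, hy⟩ := hleb a hat
      have haU : a ∈ U y := interior_subset (hy (Metric.mem_ball_self hδ))
      have hbU : b ∈ U y := interior_subset (hy (by
        rw [Metric.mem_ball, NNReal.dist_eq, hb, ha, coe_partPoint_succ_sub, abs_of_nonneg]
        · exact hn
        · positivity))
      obtain ⟨h3, h4⟩ := hU2 y a haU b hbU hab
      have hun : jumpTimes R p 0 b = jumpTimes R p 0 a ∪ jumpTimes R p a b := by
        ext r
        simp only [jumpTimes, mem_ofPred_eq, mem_union, mem_Ioc]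
        constructor
        · rintro ⟨⟨h5, h6⟩, h7⟩
          rcases le_or_gt r a with h8 | h8
          · exact Or.inl ⟨⟨h5, h8⟩, h7⟩
          · exact Or.inr ⟨⟨h8, h6⟩, h7⟩
        · rintro (⟨⟨h5, h6⟩, h7⟩ | ⟨⟨h5, h6⟩, h7⟩)
          · exact ⟨⟨h5, h6.trans hab⟩, h7⟩
          · exact ⟨⟨lt_of_le_of_lt zero_le h5, h6⟩, h7⟩
      have hdisj : Disjoint (jumpTimes R p 0 a) (jumpTimes R p a b) := by
        rw [Set.disjoint_left]
        rintro r ⟨⟨_, h5⟩, _⟩ ⟨⟨h6, _⟩, _⟩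
        exact absurd h6 (not_lt.2 h5)
      rw [hun]
      refine ⟨h1.union h3, ?_⟩
      rw [Set.ncard_union_eq hdisj h1 h3, Finset.sum_range_succ, ← h2, h4]
      push_cast
      rfl
  have h := (key n le_rfl).2
  rwa [partPoint_self t hn0] at h

/-- Along fine enough partitions, the current of a path is the sum of the currents read off from
its values at consecutive partition points. -/
theorem eventually_current_eq (hN : 3 ≤ N) {j : ℕ} (hj : j < N) {p : ℝ≥0 → Config N}
    (hrc : ∀ t, ContinuousWithinAt p (Ici t) t)
    (hll : ∀ t, 0 < t → ∃ ζ, Tendsto p (𝓝[<] t) (𝓝 ζ)) (t : ℝ≥0) :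
    ∀ᶠ n : ℕ in atTop, current p j t = ∑ l : Fin n,
      signedJump j (p (partPoint t n (l.castSucc : Fin (n + 1))))
        (p (partPoint t n (l.succ : Fin (n + 1)))) := by
  have hR : ∀ ζ : Config N, ¬ IsRightJump j ζ ζ := fun ζ h =>
    bondMove_ne_self hN hj (by rw [h.dir_eq hN]; norm_num) h.1.symm
  have hL : ∀ ζ : Config N, ¬ IsLeftJump j ζ ζ := fun ζ h =>
    bondMove_ne_self hN hj (by rw [h.dir_eq hN]; norm_num) h.1.symm
  filter_upwards [eventually_ncard_jumpTimes hR hrc hll t,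
    eventually_ncard_jumpTimes hL hrc hll t] with n h1 h2
  have e1 : (jumpsRight p j t : ℝ) = ((jumpTimes (IsRightJump j) p 0 t).ncard : ℝ) := rfl
  have e2 : (jumpsLeft p j t : ℝ) = ((jumpTimes (IsLeftJump j) p 0 t).ncard : ℝ) := rfl
  rw [current, e1, e2, h1, h2, ← Finset.sum_sub_distrib, Finset.sum_range]
  rfl

/-! ### Moments of the Cole-Hopf variable as matrix exponentials -/

/-- The sum over all discrete paths of a product of transition weights is a matrix power. -/
theorem sum_path_prod {C : Type*} [Fintype C] [DecidableEq C] (M : Matrix C C ℝ) (g : C → ℝ)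
    (n : ℕ) (a : C → ℝ) :
    ∑ x : Fin (n + 1) → C, a (x 0) * (∏ i : Fin n, M (x i.castSucc) (x i.succ)) * g (x (Fin.last n))
      = ∑ ζ, a ζ * (M ^ n).mulVec g ζ := by
  induction n generalizing a with
  | zero =>
    rw [← (Equiv.funUnique (Fin 1) C).symm.sum_comp]
    simp [uniqueElim]
  | succ n ih =>
    rw [← (Fin.consEquiv (fun _ : Fin (n + 2) => C)).sum_comp, Fintype.sum_prod_type]
    refine Finset.sum_congr rfl fun ζ _ => ?_
    have h := ih (fun ζ' => a ζ * M ζ ζ')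
    have e : (M ^ (n + 1)).mulVec g ζ = ∑ ζ', M ζ ζ' * (M ^ n).mulVec g ζ' := by
      rw [pow_succ', ← Matrix.mulVec_mulVec]; rfl
    rw [e, Finset.mul_sum]
    simp only [← mul_assoc]
    rw [← h]
    refine Finset.sum_congr rfl fun y _ => ?_
    rw [Fin.prod_univ_succ]
    simp only [Fin.consEquiv, Equiv.coe_fn_mk, Fin.cons_zero, Fin.castSucc_zero, Fin.cons_succ,
      ← Fin.succ_castSucc, ← Fin.succ_last]
    ring

/-- The logarithm of `1 + E / N`, that is, `-γ / N`. -/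
noncomputable def logRate (E : ℝ) (N : ℕ) : ℝ := Real.log (1 + E / N)

/-- The factor by which `ξ(j)` is multiplied in a transition. -/
noncomputable def twist (E : ℝ) (j : ℕ) (ζ ζ' : Config N) : ℝ :=
  Real.exp (-(logRate E N * signedJump j ζ ζ'))

/-- The generator tilted by the `m`-th power of the Cole-Hopf factor at the bond `j`. -/
noncomputable def tiltedGen (α β E : ℝ) (N j m : ℕ) : Matrix (Config N) (Config N) ℝ :=
  Matrix.of fun ζ ζ' => genMatrix α β E N ζ ζ' * twist E j ζ ζ' ^ m

/-- The value that the tilted semigroup gives to `E[ξ_t(j)^m g(η_t)]`. -/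
noncomputable def moment (α β E : ℝ) (N j : ℕ) (μ : Measure (Config N)) (m : ℕ) (t : ℝ)
    (g : Config N → ℝ) : ℝ :=
  ∑ ζ, μ.real {ζ} * Real.exp (logRate E N * height ζ j) ^ m *
    (NormedSpace.exp (t • tiltedGen α β E N j m)).mulVec g ζ

/-- The value of `ξ(j)` computed from the values `x` of the path at the points of a partition. -/
noncomputable def pathXi (E : ℝ) (j : ℕ) {n : ℕ} (x : Fin (n + 1) → Config N) : ℝ :=
  Real.exp (logRate E N * height (x 0) j) * ∏ i : Fin n, twist E j (x i.castSucc) (x i.succ)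

theorem pathXi_pos (j : ℕ) {n : ℕ} (x : Fin (n + 1) → Config N) : 0 < pathXi E j x :=
  mul_pos (Real.exp_pos _) (Finset.prod_pos fun _ _ => Real.exp_pos _)

theorem xi_eq (hN : 1 ≤ N) (p : ℝ≥0 → Config N) (t : ℝ≥0) (j : ℕ) :
    xi E p t j = Real.exp (logRate E N * (height (p 0) j - current p j t)) := by
  have hN0 : (N : ℝ) ≠ 0 := by positivity
  have h1 : gamma E N / N = -logRate E N := by
    unfold gamma logRate; field_simp
  unfold xi
  rw [h1]
  congr 1
  unfold height siteVal
  ring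

section Path

variable {S : Type*} [MeasurableSpace S] {P : Measure S} {μ : Measure (Config N)}
  {X : ℝ≥0 → S → Config N}

theorem eventually_pathXi_eq (hN : 3 ≤ N) {j : ℕ} (hj : j < N)
    (hX : IsExclusionProcess α β E N μ P X) (t : ℝ≥0) (ω : S) :
    ∀ᶠ n : ℕ in atTop, pathXi E j (fun i : Fin (n + 1) => X (partPoint t n i) ω)
      = xi E (fun s => X s ω) t j := by
  filter_upwards [eventually_current_eq hN hj (hX.right_continuous ω) (hX.left_limits ω) t] with n hn
  rw [xi_eq (by omega), hn, pathXi]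
  simp only [twist, ← Real.exp_sum, ← Real.exp_add, Fin.val_zero, partPoint_zero]
  congr 1
  rw [Finset.sum_neg_distrib, ← Finset.mul_sum]
  ring

variable [IsProbabilityMeasure P]

theorem integral_path (hX : IsExclusionProcess α β E N μ P X) (t : ℝ≥0) {n : ℕ}
    (f : (Fin (n + 1) → Config N) → ℝ) :
    ∫ ω, f (fun i => X (partPoint t n i) ω) ∂P = ∑ x : Fin (n + 1) → Config N,
      μ.real {x 0} * (∏ i : Fin n, transition α β E N (t / n) (x i.castSucc) (x i.succ)) * f x := by
  have hY : Measurable fun ω => fun i : Fin (n + 1) => X (partPoint t n i) ω :=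
    measurable_pi_iff.2 fun i => hX.measurable _
  rw [← integral_map (f := f) hY.aemeasurable (Measurable.of_discrete).aestronglyMeasurable]
  have : IsProbabilityMeasure (P.map fun ω => fun i : Fin (n + 1) => X (partPoint t n i) ω) :=
    Measure.isProbabilityMeasure_map hY.aemeasurable
  rw [integral_fintype (Integrable.of_finite)]
  refine Finset.sum_congr rfl fun x _ => ?_
  rw [smul_eq_mul]
  congr 1
  rw [map_measureReal_apply hY (measurableSet_singleton x)]
  have h := hX.law n (fun i => partPoint t n i) x
    (fun a b hab => partPoint_mono t n hab) (by simp [partPoint_zero])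
  have hset : (fun ω => fun i : Fin (n + 1) => X (partPoint t n i) ω) ⁻¹' {x}
      = {ω | ∀ i : Fin (n + 1), X (partPoint t n i) ω = x i} := by
    ext ω
    simp [funext_iff]
  rw [hset, h]
  congr 1
  refine Finset.prod_congr rfl fun i _ => ?_
  rw [Fin.val_succ, Fin.val_castSucc, coe_partPoint_succ_sub]

theorem twist_self (hN : 3 ≤ N) {j : ℕ} (hj : j < N) (ζ : Config N) : twist E j ζ ζ = 1 := by
  simp [twist, signedJump_self hN hj]

/-- The discretised moments converge to the moments given by the tilted semigroup. -/
theorem tendsto_integral_pathXi_pow (hN : 3 ≤ N) {j : ℕ} (hj : j < N)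
    (hX : IsExclusionProcess α β E N μ P X) (t : ℝ≥0) (m : ℕ) (g : Config N → ℝ) :
    Tendsto (fun n : ℕ => ∫ ω, g (X t ω) *
      pathXi E j (fun i : Fin (n + 1) => X (partPoint t n i) ω) ^ m ∂P) atTop
      (𝓝 (moment α β E N j μ m t g)) := by
  set M : ℝ → Matrix (Config N) (Config N) ℝ := fun s =>
    Matrix.of fun ζ ζ' => transition α β E N s ζ ζ' * twist E j ζ ζ' ^ m with hM
  have h0 : M 0 = 1 := by
    ext ζ ζ'
    simp only [hM, Matrix.of_apply, transition, zero_smul, NormedSpace.exp_zero]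
    rcases eq_or_ne ζ ζ' with rfl | h
    · simp [twist_self hN hj]
    · simp [h]
  have hd : ∀ ζ ζ', HasDerivAt (fun s => M s ζ ζ') (tiltedGen α β E N j m ζ ζ') 0 := by
    intro ζ ζ'
    have h1 := (hasDerivAt_exp_entry (genMatrix α β E N) 0 ζ ζ').mul_const (twist E j ζ ζ' ^ m)
    simp only [zero_smul, NormedSpace.exp_zero, Matrix.one_mul] at h1
    exact h1
  have hlim : Tendsto (fun n : ℕ => ∑ ζ, μ.real {ζ} * Real.exp (logRate E N * height ζ j) ^ m *
      (M (t / n) ^ n).mulVec g ζ) atTop (𝓝 (moment α β E N j μ m t g)) := by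
    refine tendsto_finsetSum _ fun ζ _ => Tendsto.const_mul _ ?_
    exact tendsto_finsetSum _ fun ζ' _ => (tendsto_matrix_pow_entry h0 hd t ζ ζ').mul_const _
  refine hlim.congr' ?_
  filter_upwards [eventually_gt_atTop 0] with n hn
  have h1 := integral_path hX t (n := n) (fun x => g (x (Fin.last n)) * pathXi E j x ^ m)
  simp only [Fin.val_last, partPoint_self t hn] at h1
  rw [h1, ← sum_path_prod]
  refine Finset.sum_congr rfl fun x _ => ?_
  simp only [hM, Matrix.of_apply, pathXi, mul_pow, Finset.prod_mul_distrib, Finset.prod_pow]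
  ring

/-- The value that the tilted semigroups give to the expectation of the polynomial
`∑_m G_m(η_t) ξ_t(j)^m` of degree at most `4`. -/
noncomputable def polyMoment (α β E : ℝ) (N j : ℕ) (μ : Measure (Config N)) (t : ℝ)
    (G : ℕ → Config N → ℝ) : ℝ :=
  ∑ m ∈ Finset.range 5, moment α β E N j μ m t (G m)

/-- The value of the polynomial with coefficients `G` at the configuration `ζ` and the point `x`. -/
def polyEval (G : ℕ → Config N → ℝ) (ζ : Config N) (x : ℝ) : ℝ :=
  ∑ m ∈ Finset.range 5, G m ζ * x ^ m

theorem integrable_path (hX : IsExclusionProcess α β E N μ P X) (t : ℝ≥0) {n : ℕ}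
    (f : (Fin (n + 1) → Config N) → ℝ) :
    Integrable (fun ω => f (fun i => X (partPoint t n i) ω)) P := by
  have hY : Measurable fun ω => fun i : Fin (n + 1) => X (partPoint t n i) ω :=
    measurable_pi_iff.2 fun i => hX.measurable _
  have : IsProbabilityMeasure (P.map fun ω => fun i : Fin (n + 1) => X (partPoint t n i) ω) :=
    Measure.isProbabilityMeasure_map hY.aemeasurable
  exact (Integrable.of_finite (f := f)).comp_measurable hY

theorem tendsto_integral_polyEval (hN : 3 ≤ N) {j : ℕ} (hj : j < N)
    (hX : IsExclusionProcess α β E N μ P X) (t : ℝ≥0) (G : ℕ → Config N → ℝ) :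
    Tendsto (fun n : ℕ => ∫ ω, polyEval G (X t ω)
      (pathXi E j (fun i : Fin (n + 1) => X (partPoint t n i) ω)) ∂P) atTop
      (𝓝 (polyMoment α β E N j μ t G)) := by
  have h : Tendsto (fun n : ℕ => ∑ m ∈ Finset.range 5, ∫ ω, G m (X t ω) *
      pathXi E j (fun i : Fin (n + 1) => X (partPoint t n i) ω) ^ m ∂P) atTop
      (𝓝 (polyMoment α β E N j μ t G)) :=
    tendsto_finsetSum _ fun m _ => tendsto_integral_pathXi_pow hN hj hX t m (G m)
  refine h.congr' ?_
  filter_upwards [eventually_gt_atTop 0] with n hn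
  unfold polyEval
  rw [integral_finsetSum]
  intro m _
  have h1 := integrable_path hX t (n := n) (fun x => G m (x (Fin.last n)) * pathXi E j x ^ m)
  simpa only [Fin.val_last, partPoint_self t hn] using h1

theorem polyMoment_nonneg (hN : 3 ≤ N) {j : ℕ} (hj : j < N)
    (hX : IsExclusionProcess α β E N μ P X) {t : ℝ} (ht : 0 ≤ t) {G : ℕ → Config N → ℝ}
    (hG : ∀ ζ x, 0 < x → 0 ≤ polyEval G ζ x) : 0 ≤ polyMoment α β E N j μ t G :=
  ge_of_tendsto' (tendsto_integral_polyEval hN hj hX ⟨t, ht⟩ G) fun _ =>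
    integral_nonneg fun _ => hG _ _ (pathXi_pos _ _)

theorem moment_sub (m : ℕ) (t : ℝ) (g g' : Config N → ℝ) (j : ℕ) :
    moment α β E N j μ m t (g - g') = moment α β E N j μ m t g - moment α β E N j μ m t g' := by
  simp only [moment, Matrix.mulVec_sub, Pi.sub_apply, mul_sub, Finset.sum_sub_distrib]

theorem polyMoment_mono (hN : 3 ≤ N) {j : ℕ} (hj : j < N)
    (hX : IsExclusionProcess α β E N μ P X) {t : ℝ} (ht : 0 ≤ t) {G G' : ℕ → Config N → ℝ}
    (hG : ∀ ζ x, 0 < x → polyEval G ζ x ≤ polyEval G' ζ x) :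
    polyMoment α β E N j μ t G ≤ polyMoment α β E N j μ t G' := by
  have h := polyMoment_nonneg hN hj hX ht (G := G' - G) fun ζ x hx => by
    have := hG ζ x hx
    simp only [polyEval, Pi.sub_apply, sub_mul, Finset.sum_sub_distrib] at *
    linarith
  simp only [polyMoment, Pi.sub_apply, moment_sub, Finset.sum_sub_distrib] at h ⊢
  linarith

/-- By Fatou's lemma, the expectation of a nonnegative polynomial of `ξ_t(j)` is at most the value
computed by the tilted semigroups. -/
theorem integrable_and_integral_le (hN : 3 ≤ N) {j : ℕ} (hj : j < N)
    (hX : IsExclusionProcess α β E N μ P X) (t : ℝ≥0) {G : ℕ → Config N → ℝ}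
    (hG : ∀ ζ x, 0 < x → 0 ≤ polyEval G ζ x) :
    Integrable (fun ω => polyEval G (X t ω) (xi E (fun s => X s ω) t j)) P ∧
      ∫ ω, polyEval G (X t ω) (xi E (fun s => X s ω) t j) ∂P ≤ polyMoment α β E N j μ t G := by
  set F : S → ℝ := fun ω => polyEval G (X t ω) (xi E (fun s => X s ω) t j) with hF
  -- `n + 1` intervals, so that the final partition point is `t` for every `n`
  set f : ℕ → S → ℝ := fun n ω => polyEval G (X t ω)
    (pathXi E j (fun i : Fin (n + 1 + 1) => X (partPoint t (n + 1) i) ω)) with hf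
  have hfi : ∀ n, Integrable (f n) P := by
    intro n
    have h1 := integrable_path hX t (n := n + 1)
      (fun x => polyEval G (x (Fin.last (n + 1))) (pathXi E j x))
    simpa only [Fin.val_last, partPoint_self t (Nat.succ_pos n)] using h1
  have hf0 : ∀ n ω, 0 ≤ f n ω := fun n ω => hG _ _ (pathXi_pos _ _)
  have hF0 : ∀ ω, 0 ≤ F ω := fun ω => hG _ _ (Real.exp_pos _)
  have hlim : ∀ ω, ∀ᶠ n in atTop, f n ω = F ω := by
    intro ω
    have h := (tendsto_add_atTop_nat 1).eventually (eventually_pathXi_eq hN hj hX t ω)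
    filter_upwards [h] with n hn
    simp only [hf, hF]
    rw [hn]
  have hFm : AEStronglyMeasurable F P :=
    aestronglyMeasurable_of_tendsto_ae atTop (fun n => (hfi n).aestronglyMeasurable)
      (ae_of_all _ fun ω => tendsto_nhds_of_eventually_eq (hlim ω))
  have hint : Tendsto (fun n => ∫ ω, f n ω ∂P) atTop (𝓝 (polyMoment α β E N j μ t G)) :=
    (tendsto_integral_polyEval hN hj hX t G).comp (tendsto_add_atTop_nat 1)
  have hfatou : ∫⁻ ω, ENNReal.ofReal (F ω) ∂P ≤ ENNReal.ofReal (polyMoment α β E N j μ t G) := by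
    have e1 : ∀ ω, ENNReal.ofReal (F ω) = liminf (fun n => ENNReal.ofReal (f n ω)) atTop := fun ω =>
      (tendsto_nhds_of_eventually_eq
        ((hlim ω).mono fun n hn => by rw [hn])).liminf_eq.symm
    have e2 : ∀ n, ∫⁻ ω, ENNReal.ofReal (f n ω) ∂P = ENNReal.ofReal (∫ ω, f n ω ∂P) := fun n =>
      (ofReal_integral_eq_lintegral_ofReal (hfi n) (ae_of_all _ (hf0 n))).symm
    calc ∫⁻ ω, ENNReal.ofReal (F ω) ∂P
        = ∫⁻ ω, liminf (fun n => ENNReal.ofReal (f n ω)) atTop ∂P := lintegral_congr e1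
      _ ≤ liminf (fun n => ∫⁻ ω, ENNReal.ofReal (f n ω) ∂P) atTop :=
          lintegral_liminf_le' fun n => (hfi n).aestronglyMeasurable.aemeasurable.ennreal_ofReal
      _ = ENNReal.ofReal (polyMoment α β E N j μ t G) := by
          simp only [e2]
          exact ((ENNReal.continuous_ofReal.tendsto _).comp hint).liminf_eq
  have hFi : Integrable F P := by
    refine ⟨hFm, ?_⟩
    rw [hasFiniteIntegral_iff_ofReal (ae_of_all _ hF0)]
    exact hfatou.trans_lt ENNReal.ofReal_lt_top
  refine ⟨hFi, ?_⟩
  rw [integral_eq_lintegral_of_nonneg_ae (ae_of_all _ hF0) hFm]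
  exact ENNReal.toReal_le_of_le_ofReal (ge_of_tendsto' hint fun n => integral_nonneg (hf0 n)) hfatou

end Path

/-! ### The generator on polynomials of the Cole-Hopf variable -/

variable {μ : Measure (Config N)}

theorem tiltedGen_mulVec (hN : 3 ≤ N) {j : ℕ} (hj : j < N) (m : ℕ) (g : Config N → ℝ)
    (ζ : Config N) :
    (tiltedGen α β E N j m).mulVec g ζ = (N : ℝ) ^ 2 * ∑ i ∈ Finset.range N, rate α β E i ζ *
      (Real.exp (-(logRate E N * if i = j then dir i ζ else 0)) ^ m * g (bondMove i ζ) - g ζ) := by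
  have hsingle : ∀ ζ₀ : Config N, ∑ ζ', (Pi.single ζ' (1 : ℝ) : Config N → ℝ) ζ₀ *
      (twist E j ζ ζ' ^ m * g ζ') = twist E j ζ ζ₀ ^ m * g ζ₀ := by
    intro ζ₀
    simp [Pi.single_apply]
  have h1 : (tiltedGen α β E N j m).mulVec g ζ = (N : ℝ) ^ 2 * ∑ i ∈ Finset.range N,
      rate α β E i ζ * (∑ ζ', (Pi.single ζ' (1 : ℝ) : Config N → ℝ) (bondMove i ζ) *
        (twist E j ζ ζ' ^ m * g ζ') - ∑ ζ', (Pi.single ζ' (1 : ℝ) : Config N → ℝ) ζ *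
        (twist E j ζ ζ' ^ m * g ζ')) := by
    simp only [Matrix.mulVec, dotProduct, tiltedGen, genMatrix, Matrix.of_apply, generator]
    simp only [← Finset.sum_sub_distrib, Finset.mul_sum, Finset.sum_mul]
    rw [Finset.sum_comm]
    refine Finset.sum_congr rfl fun i _ => Finset.sum_congr rfl fun ζ' _ => by ring
  rw [h1]
  congr 1
  refine Finset.sum_congr rfl fun i hi => ?_
  rw [hsingle, hsingle, twist_self hN hj, twist,
    signedJump_bondMove hN (Finset.mem_range.1 hi) hj, one_pow, one_mul]

theorem hasDerivAt_moment (j m : ℕ) {g : ℝ → Config N → ℝ} {g' : Config N → ℝ} {s : ℝ}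
    (hg : ∀ ζ, HasDerivAt (fun r => g r ζ) (g' ζ) s) :
    HasDerivAt (fun r => moment α β E N j μ m r (g r))
      (moment α β E N j μ m s ((tiltedGen α β E N j m).mulVec (g s) + g')) s := by
  unfold moment
  refine HasDerivAt.fun_sum fun ζ _ => HasDerivAt.const_mul _ ?_
  rw [Matrix.mulVec_add, Matrix.mulVec_mulVec, Pi.add_apply]
  have h : HasDerivAt (fun r => ∑ ζ', NormedSpace.exp (r • tiltedGen α β E N j m) ζ ζ' * g r ζ')
      (∑ ζ', ((NormedSpace.exp (s • tiltedGen α β E N j m) * tiltedGen α β E N j m) ζ ζ' * g s ζ'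
        + NormedSpace.exp (s • tiltedGen α β E N j m) ζ ζ' * g' ζ')) s :=
    HasDerivAt.fun_sum fun ζ' _ => (hasDerivAt_exp_entry _ s ζ ζ').mul (hg ζ')
  rw [Finset.sum_add_distrib] at h
  exact h

theorem hasDerivAt_polyMoment (j : ℕ) {G : ℝ → ℕ → Config N → ℝ} {G' : ℕ → Config N → ℝ} {s : ℝ}
    (hG : ∀ m ζ, HasDerivAt (fun r => G r m ζ) (G' m ζ) s) :
    HasDerivAt (fun r => polyMoment α β E N j μ r (G r))
      (polyMoment α β E N j μ s fun m => (tiltedGen α β E N j m).mulVec (G s m) + G' m) s :=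
  HasDerivAt.fun_sum fun m _ => hasDerivAt_moment j m (hG m)

theorem polyMoment_zero (j : ℕ) (G : ℕ → Config N → ℝ) :
    polyMoment α β E N j μ 0 G
      = ∑ ζ, μ.real {ζ} * polyEval G ζ (Real.exp (logRate E N * height ζ j)) := by
  simp only [polyMoment, moment, zero_smul, NormedSpace.exp_zero, Matrix.one_mulVec, polyEval,
    Finset.mul_sum]
  rw [Finset.sum_comm]
  exact Finset.sum_congr rfl fun ζ _ => Finset.sum_congr rfl fun m _ => by ring

/-- On polynomials the tilted generators act as the generator of the pair `(η_t, ξ_t(j))`. -/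
theorem polyEval_tiltedGen (hN : 3 ≤ N) {j : ℕ} (hj : j < N) (G : ℕ → Config N → ℝ) (ζ : Config N)
    (x : ℝ) :
    polyEval (fun m => (tiltedGen α β E N j m).mulVec (G m)) ζ x
      = (N : ℝ) ^ 2 * ∑ i ∈ Finset.range N, rate α β E i ζ *
        (polyEval G (bondMove i ζ) (x * Real.exp (-(logRate E N * if i = j then dir i ζ else 0)))
          - polyEval G ζ x) := by
  simp only [polyEval, tiltedGen_mulVec hN hj, ← Finset.sum_sub_distrib, Finset.mul_sum,
    Finset.sum_mul]
  rw [Finset.sum_comm]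
  refine Finset.sum_congr rfl fun i _ => Finset.sum_congr rfl fun m _ => ?_
  rw [mul_pow]
  ring

end WASEP

/-! ### The fourth moment inequality -/

namespace WASEP

variable {α β E : ℝ} {N : ℕ} {μ : Measure (Config N)}

/-- The coefficients of the polynomial `x ↦ (R(ζ) x - ℓ) ^ 4`. -/
def quartic (R : Config N → ℝ) (ℓ : ℝ) : ℕ → Config N → ℝ :=
  fun m ζ => (Nat.choose 4 m : ℝ) * R ζ ^ m * (-ℓ) ^ (4 - m)

theorem polyEval_quartic (R : Config N → ℝ) (ℓ : ℝ) (ζ : Config N) (x : ℝ) :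
    polyEval (quartic R ℓ) ζ x = (R ζ * x - ℓ) ^ 4 := by
  have h2 : Nat.choose 4 2 = 6 := rfl
  have h3 : Nat.choose 4 3 = 4 := rfl
  simp only [polyEval, quartic, Finset.sum_range_succ, Finset.sum_range_zero, Nat.choose_zero_right,
    Nat.choose_one_right, Nat.choose_self, h2, h3]
  push_cast
  ring

/-- The quotient `ξ(k) / ξ(j)`, a function of the configuration. -/
noncomputable def weight (E : ℝ) (j k : ℕ) (ζ : Config N) : ℝ :=
  Real.exp (-(logRate E N * height ζ j)) * Real.exp (logRate E N * height ζ k)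

theorem weight_self (j : ℕ) (ζ : Config N) : weight E j j ζ = 1 := by
  rw [weight, ← Real.exp_add]; simp

theorem weight_mul_exp (j k : ℕ) (ζ : Config N) :
    weight E j k ζ * Real.exp (logRate E N * height ζ j) = Real.exp (logRate E N * height ζ k) := by
  unfold weight
  rw [mul_right_comm, ← Real.exp_add]
  simp

/-- A jump across the bond `{i, i + 1}` changes `ξ(i)` only. -/
theorem weight_bondMove (hN : 3 ≤ N) {i j k : ℕ} (hi : i < N) (hj : j < N) (hk : k < N)
    (ζ : Config N) :
    Real.exp (-(logRate E N * if i = j then dir i ζ else 0)) * weight E j k (bondMove i ζ)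
      = weight E j k ζ + if i = k then
        weight E j k ζ * (Real.exp (-(logRate E N * dir i ζ)) - 1) else 0 := by
  have e : weight E j k ζ + (if i = k then
      weight E j k ζ * (Real.exp (-(logRate E N * dir i ζ)) - 1) else 0)
      = weight E j k ζ * Real.exp (-(logRate E N * if i = k then dir i ζ else 0)) := by
    split_ifs
    · ring
    · simp
  rw [e]
  unfold weight
  rw [height_bondMove hN hi ζ hj, height_bondMove hN hi ζ hk]
  simp only [← Real.exp_add]
  congr 1
  split_ifs <;> ring

/-- The quotient `U_s / ξ_s(j)`, where `U_s = ∑_k e^{(t - s)Ω}(a, k) ξ_s(k)` is the martingale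
with final value `ξ_t(a)`. -/
noncomputable def dualField (α β E : ℝ) (j : ℕ) (a : Fin N) (t s : ℝ) (ζ : Config N) : ℝ :=
  ∑ k : Fin N, kernel α β E N (t - s) a k * weight E j k ζ

theorem dualField_self (j : ℕ) (a : Fin N) (t : ℝ) :
    dualField α β E j a t t = weight (N := N) E j a := by
  funext ζ
  simp [dualField, kernel_zero, Matrix.one_apply]

theorem dualField_bondMove (hN : 3 ≤ N) {j : ℕ} (i : Fin N) (hj : j < N) (a : Fin N)
    (t s : ℝ) (ζ : Config N) :
    Real.exp (-(logRate E N * if (i : ℕ) = j then dir i ζ else 0)) *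
        dualField α β E j a t s (bondMove i ζ)
      = dualField α β E j a t s ζ + kernel α β E N (t - s) a i *
        (weight E j i ζ * (Real.exp (-(logRate E N * dir i ζ)) - 1)) := by
  unfold dualField
  have h : ∀ k : Fin N, Real.exp (-(logRate E N * if (i : ℕ) = j then dir i ζ else 0)) *
      (kernel α β E N (t - s) a k * weight E j k (bondMove i ζ))
      = kernel α β E N (t - s) a k * weight E j k ζ + if k = i then
        kernel α β E N (t - s) a k * (weight E j k ζ *
          (Real.exp (-(logRate E N * dir i ζ)) - 1)) else 0 := by
    intro k
    rw [mul_left_comm, weight_bondMove hN i.2 hj k.2, mul_add]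
    congr 1
    have : ((i : ℕ) = k) ↔ k = i := by rw [eq_comm, Fin.ext_iff]
    simp only [this, mul_ite, mul_zero]
  rw [Finset.mul_sum, Finset.sum_congr rfl fun k _ => h k, Finset.sum_add_distrib]
  simp

/-- The time derivative of `U` at a frozen configuration is the opposite of its mean drift, which is
the martingale property of `U`. -/
theorem hasDerivAt_dualField (hE : 0 < E) (hN : 3 ≤ N) (j : ℕ) (a : Fin N) (t s : ℝ)
    (ζ : Config N) :
    HasDerivAt (fun r => dualField α β E j a t r ζ)
      (-∑ l : Fin N, (N : ℝ) ^ 2 * rate α β E l ζ * (kernel α β E N (t - s) a l *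
        (weight E j l ζ * (Real.exp (-(logRate E N * dir l ζ)) - 1)))) s := by
  have h : HasDerivAt (fun r => dualField α β E j a t r ζ)
      (∑ k : Fin N, (∑ l, kernel α β E N (t - s) a l * omegaMatrix α β E N l k) * (-1) *
        weight E j k ζ) s := by
    refine HasDerivAt.fun_sum fun k _ => HasDerivAt.mul_const ?_ _
    exact HasDerivAt.comp s (h₂ := fun r => kernel α β E N r a k) (h := fun s => t - s)
      (hasDerivAt_kernel (t - s) a k) ((hasDerivAt_id' s).const_sub t)
  refine h.congr_deriv ?_
  have e : ∀ l : Fin N, (N : ℝ) ^ 2 * rate α β E l ζ * (kernel α β E N (t - s) a l *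
      (weight E j l ζ * (Real.exp (-(logRate E N * dir l ζ)) - 1)))
      = kernel α β E N (t - s) a l * ∑ k : Fin N, omegaMatrix α β E N l k * weight E j k ζ := by
    intro l
    rw [sum_omegaMatrix_mul (by omega) (fun k => weight E j k ζ) l]
    have h1 := rate_mul_exp_height (α := α) (β := β) hE hN l.2 ζ
      (Real.exp (-(logRate E N * height ζ j)))
    unfold weight logRate at *
    rw [← h1]
    ring
  simp only [e, Finset.mul_sum, Finset.sum_mul]
  rw [Finset.sum_comm, ← Finset.sum_neg_distrib]
  refine Finset.sum_congr rfl fun l _ => ?_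
  rw [← Finset.sum_neg_distrib]
  exact Finset.sum_congr rfl fun k _ => by ring

theorem polyEval_add (G G' : ℕ → Config N → ℝ) (ζ : Config N) (x : ℝ) :
    polyEval (G + G') ζ x = polyEval G ζ x + polyEval G' ζ x := by
  simp only [polyEval, Pi.add_apply, add_mul, Finset.sum_add_distrib]

theorem polyEval_smul (c : ℝ) (G : ℕ → Config N → ℝ) (ζ : Config N) (x : ℝ) :
    polyEval (c • G) ζ x = c * polyEval G ζ x := by
  simp only [polyEval, Pi.smul_apply, smul_eq_mul, Finset.mul_sum, mul_assoc]

theorem polyEval_sum {ι : Type*} (s : Finset ι) (G : ι → ℕ → Config N → ℝ) (ζ : Config N) (x : ℝ) :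
    polyEval (∑ i ∈ s, G i) ζ x = ∑ i ∈ s, polyEval (G i) ζ x := by
  classical
  induction s using Finset.induction_on with
  | empty => simp [polyEval]
  | insert i s hi ih => rw [Finset.sum_insert hi, Finset.sum_insert hi, polyEval_add, ih]

theorem polyMoment_add (j : ℕ) (t : ℝ) (G G' : ℕ → Config N → ℝ) :
    polyMoment α β E N j μ t (G + G')
      = polyMoment α β E N j μ t G + polyMoment α β E N j μ t G' := by
  simp only [polyMoment, moment, Pi.add_apply, Matrix.mulVec_add, mul_add, Finset.sum_add_distrib]

theorem polyMoment_smul (j : ℕ) (t c : ℝ) (G : ℕ → Config N → ℝ) :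
    polyMoment α β E N j μ t (c • G) = c * polyMoment α β E N j μ t G := by
  simp only [polyMoment, moment, Pi.smul_apply, Matrix.mulVec_smul, smul_eq_mul, Finset.mul_sum]
  exact Finset.sum_congr rfl fun m _ => Finset.sum_congr rfl fun ζ _ => by ring

theorem polyMoment_sum {ι : Type*} (j : ℕ) (t : ℝ) (s : Finset ι) (G : ι → ℕ → Config N → ℝ) :
    polyMoment α β E N j μ t (∑ i ∈ s, G i) = ∑ i ∈ s, polyMoment α β E N j μ t (G i) := by
  classical
  induction s using Finset.induction_on with
  | empty => simp [polyMoment, moment]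
  | insert i s hi ih => rw [Finset.sum_insert hi, Finset.sum_insert hi, polyMoment_add, ih]

/-- The coefficients of the time derivative of `(R x - ℓ) ^ 4`. -/
def quarticDeriv (R R' : Config N → ℝ) (ℓ : ℝ) : ℕ → Config N → ℝ :=
  fun m ζ => (Nat.choose 4 m : ℝ) * (m * R ζ ^ (m - 1) * R' ζ) * (-ℓ) ^ (4 - m)

theorem polyEval_quarticDeriv (R R' : Config N → ℝ) (ℓ : ℝ) (ζ : Config N) (x : ℝ) :
    polyEval (quarticDeriv R R' ℓ) ζ x = 4 * (R ζ * x - ℓ) ^ 3 * (R' ζ * x) := by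
  have h2 : Nat.choose 4 2 = 6 := rfl
  have h3 : Nat.choose 4 3 = 4 := rfl
  simp only [polyEval, quarticDeriv, Finset.sum_range_succ, Finset.sum_range_zero,
    Nat.choose_zero_right, Nat.choose_one_right, Nat.choose_self, h2, h3]
  push_cast
  ring

theorem hasDerivAt_quartic {R : ℝ → Config N → ℝ} {R' : Config N → ℝ} {ℓ s : ℝ}
    (hR : ∀ ζ, HasDerivAt (fun r => R r ζ) (R' ζ) s) (m : ℕ) (ζ : Config N) :
    HasDerivAt (fun r => quartic (R r) ℓ m ζ) (quarticDeriv (R s) R' ℓ m ζ) s := by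
  unfold quartic quarticDeriv
  exact (((hR ζ).fun_pow m).const_mul _).mul_const _

/-- The contribution of one jump of size `p w ε` to the drift of `Y ^ 4`, the first order term
being removed by the martingale property. -/
theorem quartic_increment_le {Y p w ε n C v : ℝ} (hn : 0 < n) (hE : 0 < E) (hp : 0 ≤ p)
    (hpC : p ≤ C) (hε : |ε| ≤ E / n) (hv : 0 < v) :
    n ^ 2 * ((Y + p * w * ε) ^ 4 - Y ^ 4 - 4 * Y ^ 3 * (p * w * ε)) ≤
      p ^ 2 * (4 * E ^ 2 * v * Y ^ 4 + (4 * E ^ 2 / v + 3 * E ^ 4 * C ^ 2 / n ^ 2) * w ^ 4) := by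
  have hε2 : n ^ 2 * ε ^ 2 ≤ E ^ 2 := by
    have h1 : ε ^ 2 ≤ (E / n) ^ 2 := sq_le_sq' (by linarith [(abs_le.1 hε).1]) (abs_le.1 hε).2
    have h2 := mul_le_mul_of_nonneg_left h1 (sq_nonneg n)
    have h3 : n ^ 2 * (E / n) ^ 2 = E ^ 2 := by field_simp
    linarith
  set b := p * w * ε with hb
  have h1 : (Y + b) ^ 4 - Y ^ 4 - 4 * Y ^ 3 * b ≤ 8 * (Y ^ 2 * b ^ 2) + 3 * b ^ 4 := by
    nlinarith [sq_nonneg (b * (Y - b)), sq_nonneg (b ^ 2), sq_nonneg (Y * b)]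
  have h2 : n ^ 2 * (8 * (Y ^ 2 * b ^ 2)) ≤ p ^ 2 * (4 * E ^ 2 * v * Y ^ 4 + 4 * E ^ 2 / v * w ^ 4) :=
    calc n ^ 2 * (8 * (Y ^ 2 * b ^ 2)) = 8 * (p ^ 2 * (Y ^ 2 * w ^ 2)) * (n ^ 2 * ε ^ 2) := by
          rw [hb]; ring
      _ ≤ 8 * (p ^ 2 * (Y ^ 2 * w ^ 2)) * E ^ 2 := by gcongr
      _ = 4 * E ^ 2 * p ^ 2 * (2 * (Y ^ 2 * w ^ 2)) := by ring
      _ ≤ 4 * E ^ 2 * p ^ 2 * (v * Y ^ 4 + w ^ 4 / v) := by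
          gcongr
          have : v * Y ^ 4 + w ^ 4 / v - 2 * (Y ^ 2 * w ^ 2) = (v * Y ^ 2 - w ^ 2) ^ 2 / v := by
            field_simp; ring
          have h3 : 0 ≤ (v * Y ^ 2 - w ^ 2) ^ 2 / v := by positivity
          linarith
      _ = _ := by ring
  have h3 : n ^ 2 * (3 * b ^ 4) ≤ p ^ 2 * (3 * E ^ 4 * C ^ 2 / n ^ 2 * w ^ 4) :=
    calc n ^ 2 * (3 * b ^ 4) = 3 * p ^ 2 * w ^ 4 / n ^ 2 * (p ^ 2 * (n ^ 2 * ε ^ 2) ^ 2) := by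
          rw [hb]; field_simp
      _ ≤ 3 * p ^ 2 * w ^ 4 / n ^ 2 * (C ^ 2 * (E ^ 2) ^ 2) := by
          have h4 : p ^ 2 ≤ C ^ 2 := pow_le_pow_left₀ hp hpC 2
          have h5 : (n ^ 2 * ε ^ 2) ^ 2 ≤ (E ^ 2) ^ 2 := pow_le_pow_left₀ (by positivity) hε2 2
          gcongr
      _ = _ := by ring
  have h4 := mul_le_mul_of_nonneg_left h1 (sq_nonneg n)
  linarith

section Path

variable {S : Type*} [MeasurableSpace S] {P : Measure S} [IsProbabilityMeasure P]
  {X : ℝ≥0 → S → Config N}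

/-- The fourth moment of the martingale `U_s - ℓ` grows at the rate of its bracket, which is
controlled by the squared kernel and the fourth moments of `ξ`. The parameter `v` balances the two
terms. -/
theorem polyMoment_weight_le (hE : 0 < E) (hα : α ∈ Ioo (0 : ℝ) 1) (hβ : β ∈ Ioo (0 : ℝ) 1)
    (hN : 3 ≤ N) {j : ℕ} (hj : j < N) (hX : IsExclusionProcess α β E N μ P X) (a : Fin N) {t : ℝ}
    (ht : 0 ≤ t) (ℓ : ℝ) {v C M : ℝ} (hv : 0 < v)
    (hC : ∀ s ∈ Icc 0 t, ∀ k, kernel α β E N s a k ≤ C)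
    (hM0 : 0 ≤ M)
    (hM : ∀ s ∈ Icc 0 t, ∀ k : Fin N, polyMoment α β E N j μ s (quartic (weight E j k) 0) ≤ M) :
    polyMoment α β E N j μ t (quartic (weight E j a) ℓ) ≤
      Real.exp ((1 + E) * (4 * E ^ 2 * v) * ∫ s in (0 : ℝ)..t, ∑ k, kernel α β E N (t - s) a k ^ 2)
        * (polyMoment α β E N j μ 0 (quartic (dualField α β E j a t 0) ℓ)
          + (1 + E) * (4 * E ^ 2 / v + 3 * E ^ 4 * C ^ 2 / N ^ 2) * M *
            ∫ s in (0 : ℝ)..t, ∑ k, kernel α β E N (t - s) a k ^ 2) := by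
  have hNpos : (0 : ℝ) < N := by positivity
  set c := 4 * E ^ 2 / v + 3 * E ^ 4 * C ^ 2 / (N : ℝ) ^ 2 with hc
  have hc0 : 0 ≤ c := by positivity
  set R' : ℝ → Config N → ℝ := fun s ζ => -∑ l : Fin N, (N : ℝ) ^ 2 * rate α β E l ζ *
    (kernel α β E N (t - s) a l * (weight E j l ζ *
      (Real.exp (-(logRate E N * dir l ζ)) - 1))) with hR'
  set y : ℝ → ℝ := fun s => polyMoment α β E N j μ s (quartic (dualField α β E j a t s) ℓ) with hy
  set G' : ℝ → ℕ → Config N → ℝ := fun s m =>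
    (tiltedGen α β E N j m).mulVec (quartic (dualField α β E j a t s) ℓ m)
      + quarticDeriv (dualField α β E j a t s) (R' s) ℓ m with hG'
  have hyd : ∀ s, HasDerivAt y (polyMoment α β E N j μ s (G' s)) s := fun s =>
    hasDerivAt_polyMoment j (G := fun s => quartic (dualField α β E j a t s) ℓ) fun m ζ =>
      hasDerivAt_quartic (fun ζ => hasDerivAt_dualField hE hN j a t s ζ) m ζ
  have hle : ∀ s ∈ Icc 0 t, polyMoment α β E N j μ s (G' s) ≤
      (∑ k, kernel α β E N (t - s) a k ^ 2) *
        ((1 + E) * (4 * E ^ 2 * v) * y s + (1 + E) * c * M) := by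
    intro s hs
    have hts : t - s ∈ Icc 0 t := ⟨by linarith [hs.2], by linarith [hs.1]⟩
    have hp0 : ∀ k, 0 ≤ kernel α β E N (t - s) a k := fun k =>
      kernel_nonneg hE (by omega) hts.1 a k
    have hpt : ∀ ζ x, 0 < x → polyEval (G' s) ζ x ≤ polyEval
        (((∑ k, kernel α β E N (t - s) a k ^ 2) * ((1 + E) * (4 * E ^ 2 * v))) •
            quartic (dualField α β E j a t s) ℓ
          + ∑ k : Fin N, ((1 + E) * c * kernel α β E N (t - s) a k ^ 2) •
            quartic (weight E j k) 0) ζ x := by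
      intro ζ x _
      set Y := dualField α β E j a t s ζ * x - ℓ with hY
      have e1 : polyEval (G' s) ζ x = ∑ i : Fin N, rate α β E i ζ * ((N : ℝ) ^ 2 *
          ((Y + kernel α β E N (t - s) a i * (weight E j i ζ * x) *
            (Real.exp (-(logRate E N * dir i ζ)) - 1)) ^ 4 - Y ^ 4 - 4 * Y ^ 3 *
            (kernel α β E N (t - s) a i * (weight E j i ζ * x) *
            (Real.exp (-(logRate E N * dir i ζ)) - 1)))) := by
        have e2 : polyEval (G' s) ζ x = polyEval (fun m => (tiltedGen α β E N j m).mulVec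
            (quartic (dualField α β E j a t s) ℓ m)) ζ x
            + polyEval (quarticDeriv (dualField α β E j a t s) (R' s) ℓ) ζ x :=
          polyEval_add _ _ ζ x
        rw [e2, polyEval_tiltedGen hN hj, polyEval_quarticDeriv, Finset.sum_range]
        simp only [polyEval_quartic, hR']
        rw [neg_mul, Finset.sum_mul, mul_neg, Finset.mul_sum, Finset.mul_sum, ← sub_eq_add_neg,
          ← Finset.sum_sub_distrib]
        refine Finset.sum_congr rfl fun i _ => ?_
        have e3 := dualField_bondMove (α := α) (β := β) (E := E) hN i hj a t s ζ
        have e4 : dualField α β E j a t s (bondMove i ζ) *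
            (x * Real.exp (-(logRate E N * if (i : ℕ) = j then dir i ζ else 0))) - ℓ
            = Y + kernel α β E N (t - s) a i * (weight E j i ζ * x) *
            (Real.exp (-(logRate E N * dir i ζ)) - 1) := by
          rw [mul_comm x, ← mul_assoc, mul_comm (dualField α β E j a t s (bondMove i ζ)), e3, hY]
          ring
        rw [e4, ← hY]
        ring
      rw [e1, polyEval_add, polyEval_smul, polyEval_sum]
      simp only [polyEval_smul, polyEval_quartic, ← hY, sub_zero, Finset.sum_mul]
      rw [← Finset.sum_add_distrib]
      refine Finset.sum_le_sum fun i _ => ?_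
      have h1 := quartic_increment_le (Y := Y) (w := weight E j i ζ * x) hNpos hE (hp0 i)
        (hC _ hts i) (abs_exp_dir_sub_one_le (N := N) hE (by omega) i ζ) hv
      have h2 : 0 ≤ kernel α β E N (t - s) a i ^ 2 *
          (4 * E ^ 2 * v * Y ^ 4 + c * (weight E j i ζ * x) ^ 4) := by positivity
      calc _ ≤ rate α β E i ζ * (kernel α β E N (t - s) a i ^ 2 *
            (4 * E ^ 2 * v * Y ^ 4 + c * (weight E j i ζ * x) ^ 4)) :=
            mul_le_mul_of_nonneg_left h1 (rate_nonneg hE hα hβ i ζ)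
        _ ≤ (1 + E) * (kernel α β E N (t - s) a i ^ 2 *
            (4 * E ^ 2 * v * Y ^ 4 + c * (weight E j i ζ * x) ^ 4)) :=
            mul_le_mul_of_nonneg_right (rate_le hE (by omega) hα hβ i ζ) h2
        _ = _ := by ring
    refine (polyMoment_mono hN hj hX hs.1 hpt).trans ?_
    rw [polyMoment_add, polyMoment_smul, polyMoment_sum]
    simp only [polyMoment_smul]
    have h3 : ∑ k : Fin N, (1 + E) * c * kernel α β E N (t - s) a k ^ 2 *
        polyMoment α β E N j μ s (quartic (weight E j k) 0)
        ≤ ∑ k : Fin N, (1 + E) * c * kernel α β E N (t - s) a k ^ 2 * M :=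
      Finset.sum_le_sum fun k _ => mul_le_mul_of_nonneg_left (hM s hs k) (by positivity)
    have h4 : ∑ k : Fin N, (1 + E) * c * kernel α β E N (t - s) a k ^ 2 * M
        = (∑ k, kernel α β E N (t - s) a k ^ 2) * ((1 + E) * c * M) := by
      rw [Finset.sum_mul]
      exact Finset.sum_congr rfl fun k _ => by ring
    rw [h4] at h3
    refine (add_le_add_right h3 _).trans (le_of_eq ?_)
    simp only [hy]
    ring
  have h := gronwall_integral_rate (y := y) (κ := fun s => ∑ k, kernel α β E N (t - s) a k ^ 2) ht
    (A := (1 + E) * (4 * E ^ 2 * v)) (B := (1 + E) * c * M) (by positivity) (by positivity)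
    (continuous_finsetSum _ fun k _ =>
      ((continuous_kernel a k).comp (continuous_const.sub continuous_id)).pow 2)
    (fun s _ => Finset.sum_nonneg fun k _ => sq_nonneg _)
    (fun s _ => (hyd s).hasDerivWithinAt) hle
  simpa only [hy, dualField_self] using h

/-! ### Constants, uniform in `N`, `α` and the initial data -/

/-- A bound for the row sums of the kernel up to time `T`. -/
noncomputable def rowBound (E T : ℝ) : ℝ :=
  Real.exp ((3 * E + 3) ^ 2 * T) * (Real.exp (3 * E + 3) + 1)

/-- `N` times a bound for the space-time `L²` norm squared of the kernel up to time `T`. -/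
noncomputable def energyBound (E T : ℝ) : ℝ := 2 * Real.exp (2 * E + 2 * shift E * T)

/-- The coefficient of the fourth moments of `ξ` in the fourth moment inequality. -/
noncomputable def noiseBound (E T : ℝ) : ℝ :=
  (1 + E) * (4 * E ^ 2 + 3 * E ^ 4 * rowBound E T ^ 2)

/-- A bound for the fourth moments of `ξ` up to time `T`. -/
noncomputable def momentBound (E T : ℝ) : ℝ :=
  2 * (Real.exp 1 * (rowBound E T * Real.exp E) ^ 4)

theorem rowBound_pos (E T : ℝ) : 0 < rowBound E T := by unfold rowBound; positivity

theorem noiseBound_pos (hE : 0 < E) (T : ℝ) : 0 < noiseBound E T := by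
  unfold noiseBound; positivity

theorem momentBound_pos (E T : ℝ) : 0 < momentBound E T := by
  unfold momentBound
  have := rowBound_pos E T
  positivity

theorem sum_kernel_le_rowBound (hE : 0 < E) (hα : α ∈ Ioo (0 : ℝ) 1) (hβ : β ∈ Ioo (0 : ℝ) 1)
    (hN : 3 ≤ N) (hN' : 6 * E + 6 ≤ N) {t T : ℝ} (ht : 0 ≤ t) (htT : t ≤ T) (a : Fin N) :
    ∑ k, kernel α β E N t a k ≤ rowBound E T := by
  refine (sum_kernel_le hE hα.1.le hβ.2.le hN hN' ht a).trans ?_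
  unfold rowBound
  gcongr

theorem kernel_le_rowBound (hE : 0 < E) (hα : α ∈ Ioo (0 : ℝ) 1) (hβ : β ∈ Ioo (0 : ℝ) 1)
    (hN : 3 ≤ N) (hN' : 6 * E + 6 ≤ N) {t T : ℝ} (ht : 0 ≤ t) (htT : t ≤ T) (a k : Fin N) :
    kernel α β E N t a k ≤ rowBound E T :=
  (Finset.single_le_sum (f := fun k => kernel α β E N t a k)
    (fun k _ => kernel_nonneg hE (by omega) ht a k) (Finset.mem_univ k)).trans
    (sum_kernel_le_rowBound hE hα hβ hN hN' ht htT a)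

theorem integral_kernel_sq_le_energyBound (hE : 0 < E) (hα : α ∈ Ioo (0 : ℝ) 1)
    (hβ : β ∈ Ioo (0 : ℝ) 1) (hN : 3 ≤ N) {t T : ℝ} (ht : 0 ≤ t) (htT : t ≤ T) (a : Fin N) :
    ∫ s in (0 : ℝ)..t, ∑ k, kernel α β E N (t - s) a k ^ 2 ≤ energyBound E T / N := by
  refine (integral_sum_kernel_sq_le hE hα.1.le hβ.2.le (by omega) ht a).trans ?_
  have := shift_pos hE
  unfold energyBound
  gcongr

theorem integral_kernel_sq_nonneg {t : ℝ} (ht : 0 ≤ t) (a : Fin N) :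
    0 ≤ ∫ s in (0 : ℝ)..t, ∑ k, kernel α β E N (t - s) a k ^ 2 :=
  intervalIntegral.integral_nonneg ht fun _ _ => Finset.sum_nonneg fun _ _ => sq_nonneg _

theorem logRate_nonneg (hE : 0 < E) : 0 ≤ logRate E N :=
  Real.log_nonneg (by simp; positivity)

theorem logRate_le (hE : 0 < E) : logRate E N ≤ E / N := by
  have h := Real.log_le_sub_one_of_pos (show 0 < 1 + E / (N : ℝ) by positivity)
  unfold logRate; linarith

theorem logRate_mul_le (hE : 0 < E) {k : ℕ} (hk : k < N) {r : ℝ} (hr : r ≤ k) :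
    logRate E N * r ≤ E := by
  have hNpos : (0 : ℝ) < N := by exact_mod_cast (Nat.zero_le k).trans_lt hk
  have hkN : (k : ℝ) ≤ N := by exact_mod_cast hk.le
  calc logRate E N * r ≤ logRate E N * N :=
        mul_le_mul_of_nonneg_left (hr.trans hkN) (logRate_nonneg hE)
    _ ≤ E / N * N := mul_le_mul_of_nonneg_right (logRate_le hE) hNpos.le
    _ = E := div_mul_cancel₀ E hNpos.ne'

theorem dualField_zero_mul_exp (j : ℕ) (a : Fin N) (t : ℝ) (ζ : Config N) :
    dualField α β E j a t 0 ζ * Real.exp (logRate E N * height ζ j)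
      = ∑ k : Fin N, kernel α β E N t a k * Real.exp (logRate E N * height ζ k) := by
  unfold dualField
  rw [Finset.sum_mul]
  refine Finset.sum_congr rfl fun k _ => ?_
  rw [mul_assoc, weight_mul_exp, sub_zero]

theorem polyMoment_dualField_zero_le (hE : 0 < E) (hα : α ∈ Ioo (0 : ℝ) 1)
    (hβ : β ∈ Ioo (0 : ℝ) 1) (hN : 3 ≤ N) (hN' : 6 * E + 6 ≤ N) [IsProbabilityMeasure μ]
    (j : ℕ) {t T : ℝ} (ht : 0 ≤ t) (htT : t ≤ T) (a : Fin N) :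
    polyMoment α β E N j μ 0 (quartic (dualField α β E j a t 0) 0)
      ≤ (rowBound E T * Real.exp E) ^ 4 := by
  rw [polyMoment_zero]
  calc _ ≤ ∑ ζ, μ.real {ζ} * (rowBound E T * Real.exp E) ^ 4 := by
        refine Finset.sum_le_sum fun ζ _ => mul_le_mul_of_nonneg_left ?_ measureReal_nonneg
        rw [polyEval_quartic, sub_zero, dualField_zero_mul_exp]
        refine pow_le_pow_left₀ (Finset.sum_nonneg fun k _ => mul_nonneg
          (kernel_nonneg hE (by omega) ht a k) (Real.exp_pos _).le) ?_ 4
        calc _ ≤ ∑ k : Fin N, kernel α β E N t a k * Real.exp E :=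
              Finset.sum_le_sum fun k _ => mul_le_mul_of_nonneg_left
                (Real.exp_le_exp.2 (logRate_mul_le hE k.2 (height_le ζ k)))
                (kernel_nonneg hE (by omega) ht a k)
          _ = (∑ k : Fin N, kernel α β E N t a k) * Real.exp E := by rw [Finset.sum_mul]
          _ ≤ _ := mul_le_mul_of_nonneg_right
              (sum_kernel_le_rowBound hE hα hβ hN hN' ht htT a) (Real.exp_pos _).le
    _ = _ := by rw [← Finset.sum_mul]; simp

/-- The fourth moments of `ξ` are bounded up to time `T`: the maximal one satisfies an inequality
in which it reappears with a factor of order `1 / N`. -/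
theorem polyMoment_weight_le_momentBound (hE : 0 < E) (hα : α ∈ Ioo (0 : ℝ) 1)
    (hβ : β ∈ Ioo (0 : ℝ) 1) (hN : 3 ≤ N) (hN' : 6 * E + 6 ≤ N) [IsProbabilityMeasure μ]
    {j : ℕ} (hj : j < N) (hX : IsExclusionProcess α β E N μ P X) {T : ℝ} (hT : 0 ≤ T)
    (hN1 : (1 + E) * (4 * E ^ 2) * energyBound E T ≤ N)
    (hN2 : 2 * (Real.exp 1 * (noiseBound E T * energyBound E T)) ≤ N) :
    ∀ s ∈ Icc 0 T, ∀ k : Fin N,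
      polyMoment α β E N j μ s (quartic (weight E j k) 0) ≤ momentBound E T := by
  have hNpos : (0 : ℝ) < N := by positivity
  set F : Fin N → ℝ → ℝ := fun k s => polyMoment α β E N j μ s (quartic (weight E j k) 0) with hF
  have hFc : ∀ k, Continuous (F k) := fun k => continuous_iff_continuousAt.2 fun s =>
    (hasDerivAt_polyMoment j (G := fun _ => quartic (weight E j k) 0) (G' := 0)
      fun m ζ => hasDerivAt_const s _).continuousAt
  have hmax : ∀ k, ∃ s ∈ Icc 0 T, ∀ r ∈ Icc 0 T, F k r ≤ F k s := fun k => by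
    obtain ⟨s, hs, h⟩ := isCompact_Icc.exists_isMaxOn (nonempty_Icc.2 hT) (hFc k).continuousOn
    exact ⟨s, hs, fun r hr => h hr⟩
  -- `M` is the largest fourth moment over all sites and all times in `[0, T]`
  choose τ hτ hτmax using hmax
  have : Nonempty (Fin N) := ⟨⟨0, by omega⟩⟩
  obtain ⟨a, ha⟩ := Finite.exists_max fun k => F k (τ k)
  set M := F a (τ a) with hM
  have hbound : ∀ s ∈ Icc 0 T, ∀ k, F k s ≤ M := fun s hs k => (hτmax k s hs).trans (ha k)
  have hM0 : 0 ≤ M := polyMoment_nonneg hN hj hX (hτ a).1 fun ζ x _ => by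
    rw [polyEval_quartic]; positivity
  have h := polyMoment_weight_le hE hα hβ hN hj hX a (hτ a).1 0 (v := 1) (M := M) one_pos
    (fun s hs k => kernel_le_rowBound hE hα hβ hN hN' hs.1 (hs.2.trans (hτ a).2) a k) hM0
    fun s hs k => hbound s ⟨hs.1, hs.2.trans (hτ a).2⟩ k
  set I := ∫ s in (0 : ℝ)..τ a, ∑ k, kernel α β E N (τ a - s) a k ^ 2
  have hI : I ≤ energyBound E T / N :=
    integral_kernel_sq_le_energyBound hE hα hβ hN (hτ a).1 (hτ a).2 a
  have hI0 : 0 ≤ I := integral_kernel_sq_nonneg (hτ a).1 a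
  have hinit := polyMoment_dualField_zero_le (μ := μ) hE hα hβ hN hN' j (hτ a).1 (hτ a).2 a
  have hexp : Real.exp ((1 + E) * (4 * E ^ 2 * 1) * I) ≤ Real.exp 1 := by
    refine Real.exp_le_exp.2 ?_
    calc (1 + E) * (4 * E ^ 2 * 1) * I ≤ (1 + E) * (4 * E ^ 2 * 1) * (energyBound E T / N) := by
          gcongr
      _ = (1 + E) * (4 * E ^ 2) * energyBound E T / N := by ring
      _ ≤ 1 := (div_le_one hNpos).2 hN1
  have hN1' : (1 : ℝ) ≤ N ^ 2 := one_le_pow₀ (by exact_mod_cast (by omega : 1 ≤ N))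
  have hcoef : (1 + E) * (4 * E ^ 2 / 1 + 3 * E ^ 4 * rowBound E T ^ 2 / N ^ 2)
      ≤ noiseBound E T := by
    unfold noiseBound
    rw [div_one]
    gcongr
    exact div_le_self (by positivity) hN1'
  have hnoise : (1 + E) * (4 * E ^ 2 / 1 + 3 * E ^ 4 * rowBound E T ^ 2 / N ^ 2) * M * I
      ≤ noiseBound E T * M * (energyBound E T / N) := by
    have := noiseBound_pos hE T
    gcongr
  have h1 : M ≤ Real.exp 1 * ((rowBound E T * Real.exp E) ^ 4
      + noiseBound E T * M * (energyBound E T / N)) := by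
    refine h.trans ?_
    have h0 : 0 ≤ polyMoment α β E N j μ 0 (quartic (dualField α β E j a (τ a) 0) 0) :=
      polyMoment_nonneg hN hj hX le_rfl fun ζ x _ => by rw [polyEval_quartic]; positivity
    have hr := rowBound_pos E T
    exact mul_le_mul hexp (add_le_add hinit hnoise) (by positivity) (Real.exp_pos _).le
  have h2 : Real.exp 1 * (noiseBound E T * M * (energyBound E T / N)) ≤ M / 2 := by
    have e : Real.exp 1 * (noiseBound E T * M * (energyBound E T / N))
        = M / 2 * (2 * (Real.exp 1 * (noiseBound E T * energyBound E T)) / N) := by ring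
    rw [e]
    exact mul_le_of_le_one_right (by positivity) ((div_le_one hNpos).2 hN2)
  intro s hs k
  refine (hbound s hs k).trans ?_
  unfold momentBound
  linarith

/-! ### The initial error and the deterministic solution -/

theorem abs_exp_sub_exp_le {a b c : ℝ} (ha : a ≤ c) (hb : b ≤ c) :
    |Real.exp a - Real.exp b| ≤ Real.exp c * |a - b| := by
  have key : ∀ a b : ℝ, a ≤ c → Real.exp a - Real.exp b ≤ Real.exp c * |a - b| := by
    intro a b ha
    have h1 : Real.exp a - Real.exp b = Real.exp a * (1 - Real.exp (b - a)) := by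
      rw [mul_sub, mul_one, ← Real.exp_add]; congr 2; ring
    have h2 := Real.add_one_le_exp (b - a)
    have h3 : 1 - Real.exp (b - a) ≤ |a - b| := by
      have := le_abs_self (a - b); linarith
    rw [h1]
    calc _ ≤ Real.exp a * |a - b| := mul_le_mul_of_nonneg_left h3 (Real.exp_pos a).le
      _ ≤ _ := mul_le_mul_of_nonneg_right (Real.exp_le_exp.2 ha) (abs_nonneg _)
  rw [abs_le]
  constructor
  · have := key b a hb; rw [abs_sub_comm] at this; linarith
  · exact key a b ha

/-- Jensen's inequality for the fourth power. -/
theorem sum_mul_pow_four_le {ι : Type*} (s : Finset ι) {p z : ι → ℝ} (hp : ∀ i, 0 ≤ p i) :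
    (∑ i ∈ s, p i * z i) ^ 4 ≤ (∑ i ∈ s, p i) ^ 3 * ∑ i ∈ s, p i * z i ^ 4 := by
  have hP : 0 ≤ ∑ i ∈ s, p i := Finset.sum_nonneg fun i _ => hp i
  have key : ∀ u : ι → ℝ, (∑ i ∈ s, p i * u i) ^ 2 ≤ (∑ i ∈ s, p i) * ∑ i ∈ s, p i * u i ^ 2 :=
    fun u => Finset.sum_sq_le_sum_mul_sum_of_sq_le_mul s (fun i _ => hp i)
      (fun i _ => mul_nonneg (hp i) (sq_nonneg _)) fun i _ => le_of_eq (by ring)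
  have h1 := key z
  have h2 := key fun i => z i ^ 2
  have h3 : 0 ≤ ∑ i ∈ s, p i * z i ^ 2 :=
    Finset.sum_nonneg fun i _ => mul_nonneg (hp i) (sq_nonneg _)
  have e : ∑ i ∈ s, p i * (z i ^ 2) ^ 2 = ∑ i ∈ s, p i * z i ^ 4 :=
    Finset.sum_congr rfl fun i _ => by ring
  rw [e] at h2
  calc (∑ i ∈ s, p i * z i) ^ 4 = ((∑ i ∈ s, p i * z i) ^ 2) ^ 2 := by ring
    _ ≤ ((∑ i ∈ s, p i) * ∑ i ∈ s, p i * z i ^ 2) ^ 2 := pow_le_pow_left₀ (sq_nonneg _) h1 2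
    _ = (∑ i ∈ s, p i) ^ 2 * (∑ i ∈ s, p i * z i ^ 2) ^ 2 := by ring
    _ ≤ (∑ i ∈ s, p i) ^ 2 * ((∑ i ∈ s, p i) * ∑ i ∈ s, p i * z i ^ 4) :=
        mul_le_mul_of_nonneg_left h2 (sq_nonneg _)
    _ = _ := by ring

/-- Duhamel's formula; it applies to any solution of the linear equation, and so contains its
uniqueness. -/
theorem IsLinearSolution.eq_sum_kernel (hN : 2 ≤ N) {ρ₀ : ℝ → ℝ} {lam : ℝ → ℕ → ℝ}
    (hlam : IsLinearSolution α β E N ρ₀ lam) {t : ℝ} (ht : 0 ≤ t) (a : Fin N) :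
    lam t a = ∑ k : Fin N, kernel α β E N t a k * lam 0 k := by
  -- the derivatives of the two factors cancel, so this function is constant on `[0, t]`
  set φ : ℝ → ℝ := fun s => ∑ k : Fin N, kernel α β E N (t - s) a k * lam s k with hφ
  have hd : ∀ s, 0 ≤ s → HasDerivWithinAt φ 0 (Ici 0) s := by
    intro s hs
    have h : HasDerivWithinAt φ (∑ k : Fin N,
        ((∑ l, kernel α β E N (t - s) a l * omegaMatrix α β E N l k) * (-1) * lam s k
          + kernel α β E N (t - s) a k * Omega α β E N (lam s) k)) (Ici 0) s := by
      refine HasDerivWithinAt.fun_sum fun k _ => HasDerivWithinAt.mul ?_ (hlam.deriv s hs k k.2)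
      exact (HasDerivAt.comp s (h₂ := fun r => kernel α β E N r a k) (h := fun s => t - s)
        (hasDerivAt_kernel (t - s) a k) ((hasDerivAt_id' s).const_sub t)).hasDerivWithinAt
    refine h.congr_deriv ?_
    simp only [← sum_omegaMatrix_mul hN (lam s), Finset.sum_add_distrib, Finset.sum_mul,
      Finset.mul_sum]
    rw [Finset.sum_comm, ← Finset.sum_add_distrib]
    refine Finset.sum_eq_zero fun l _ => ?_
    rw [← Finset.sum_add_distrib]
    exact Finset.sum_eq_zero fun k _ => by ring
  have hconst := constant_of_has_deriv_right_zero (f := φ) (a := 0) (b := t)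
    (fun s hs => (hd s hs.1).continuousWithinAt.mono Icc_subset_Ici_self)
    (fun s hs => (hd s hs.1).mono (Ici_subset_Ici.2 hs.1)) t (right_mem_Icc.2 ht)
  simpa [hφ, kernel_zero, Matrix.one_apply] using hconst

/-- The initial values of `ξ` and of the deterministic solution are close in `L⁴`. -/
theorem sum_initial_error_le (hE : 0 < E) (hN : 3 ≤ N) {ρ₀ : ℝ → ℝ} {A : ℝ}
    (hρ : ∀ x ∈ Icc (0 : ℝ) 1, ρ₀ x ∈ Icc (0 : ℝ) 1) {μ : (N : ℕ) → Measure (Config N)}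
    [IsProbabilityMeasure (μ N)] (hμ : InitialBound ρ₀ A μ) {lam : ℝ → ℕ → ℝ}
    (hlam : IsLinearSolution α β E N ρ₀ lam) {k : ℕ} (hk : k < N) :
    ∑ ζ, (μ N).real {ζ} * (Real.exp (logRate E N * height ζ k) - lam 0 k) ^ 4
      ≤ (Real.exp E * E) ^ 4 * |A| / N ^ 2 := by
  have hNpos : (0 : ℝ) < N := by positivity
  set r : ℝ := ∑ l ∈ Finset.Icc 1 k, ρ₀ ((l : ℝ) / N) with hr
  have hrk : r ≤ k := by
    calc r ≤ ∑ l ∈ Finset.Icc 1 k, (1 : ℝ) := by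
          refine Finset.sum_le_sum fun l hl => (hρ _ ⟨by positivity, ?_⟩).2
          rw [div_le_one hNpos]
          have := (Finset.mem_Icc.1 hl).2
          exact_mod_cast (by omega : l ≤ N)
      _ = k := by simp
  have hlam0 : lam 0 k = Real.exp (logRate E N * r) := by
    rw [hlam.initial k hk]
    have e : -(gamma E N / N) = logRate E N := by
      unfold gamma logRate
      field_simp
    rw [e]
  have hpt : ∀ ζ : Config N, (Real.exp (logRate E N * height ζ k) - lam 0 k) ^ 4
      ≤ (Real.exp E * E) ^ 4 / N ^ 2 * (1 / Real.sqrt N * (height ζ k - r)) ^ 4 := by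
    intro ζ
    have h1 : |Real.exp (logRate E N * height ζ k) - lam 0 k|
        ≤ Real.exp E * E / N * |height ζ k - r| := by
      rw [hlam0]
      refine (abs_exp_sub_exp_le (logRate_mul_le hE hk (height_le ζ k))
        (logRate_mul_le hE hk hrk)).trans ?_
      rw [← mul_sub, abs_mul, abs_of_nonneg (logRate_nonneg hE), mul_div_assoc, mul_assoc]
      gcongr
      exact logRate_le hE
    have h2 := pow_le_pow_left₀ (abs_nonneg _) h1 4
    have hsq : Real.sqrt N ^ 4 = (N : ℝ) ^ 2 := by
      rw [show (4 : ℕ) = 2 * 2 from rfl, pow_mul, Real.sq_sqrt hNpos.le]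
    rw [mul_pow, Even.pow_abs (by decide), Even.pow_abs (by decide)] at h2
    refine h2.trans (le_of_eq ?_)
    rw [mul_pow (1 / _), div_pow, div_pow, hsq]
    field_simp
  have hmom : ∑ ζ, (μ N).real {ζ} * (1 / Real.sqrt N * (height ζ k - r)) ^ 4 ≤ |A| := by
    rcases Nat.eq_zero_or_pos k with rfl | hk0
    · simp [height_zero, hr]
    · have h := hμ N (by omega) k (Finset.mem_Icc.2 ⟨hk0, by omega⟩)
      rw [integral_fintype (Integrable.of_finite)] at h
      refine le_trans (le_of_eq ?_) (h.trans (le_abs_self A))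
      refine Finset.sum_congr rfl fun ζ _ => ?_
      rw [smul_eq_mul, Finset.sum_sub_distrib]
      rfl
  calc _ ≤ ∑ ζ, (μ N).real {ζ} * ((Real.exp E * E) ^ 4 / N ^ 2 *
        (1 / Real.sqrt N * (height ζ k - r)) ^ 4) :=
        Finset.sum_le_sum fun ζ _ => mul_le_mul_of_nonneg_left (hpt ζ) measureReal_nonneg
    _ = (Real.exp E * E) ^ 4 / N ^ 2 *
        ∑ ζ, (μ N).real {ζ} * (1 / Real.sqrt N * (height ζ k - r)) ^ 4 := by
        rw [Finset.mul_sum]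
        exact Finset.sum_congr rfl fun ζ _ => by ring
    _ ≤ (Real.exp E * E) ^ 4 / N ^ 2 * |A| := mul_le_mul_of_nonneg_left hmom (by positivity)
    _ = _ := by ring

theorem polyMoment_dualField_initial_le (hE : 0 < E) (hα : α ∈ Ioo (0 : ℝ) 1)
    (hβ : β ∈ Ioo (0 : ℝ) 1) (hN : 3 ≤ N) (hN' : 6 * E + 6 ≤ N) {ρ₀ : ℝ → ℝ} {A : ℝ}
    (hρ : ∀ x ∈ Icc (0 : ℝ) 1, ρ₀ x ∈ Icc (0 : ℝ) 1) {μ : (N : ℕ) → Measure (Config N)}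
    [IsProbabilityMeasure (μ N)] (hμ : InitialBound ρ₀ A μ) {lam : ℝ → ℕ → ℝ}
    (hlam : IsLinearSolution α β E N ρ₀ lam) (j : ℕ) {t T : ℝ} (ht : 0 ≤ t) (htT : t ≤ T)
    (a : Fin N) :
    polyMoment α β E N j (μ N) 0 (quartic (dualField α β E j a t 0) (lam t a))
      ≤ rowBound E T ^ 4 * ((Real.exp E * E) ^ 4 * |A| / N ^ 2) := by
  have hp0 : ∀ k, 0 ≤ kernel α β E N t a k := fun k => kernel_nonneg hE (by omega) ht a k
  have hrow := sum_kernel_le_rowBound hE hα hβ hN hN' ht htT a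
  have hrow0 : 0 ≤ ∑ k, kernel α β E N t a k := Finset.sum_nonneg fun k _ => hp0 k
  set D := (Real.exp E * E) ^ 4 * |A| / (N : ℝ) ^ 2
  have hD : 0 ≤ D := by positivity
  rw [polyMoment_zero]
  simp only [polyEval_quartic, dualField_zero_mul_exp, hlam.eq_sum_kernel (by omega) ht a,
    ← Finset.sum_sub_distrib, ← mul_sub]
  calc _ ≤ ∑ ζ, (μ N).real {ζ} * ((∑ k, kernel α β E N t a k) ^ 3 * ∑ k : Fin N,
        kernel α β E N t a k * (Real.exp (logRate E N * height ζ k) - lam 0 k) ^ 4) :=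
        Finset.sum_le_sum fun ζ _ => mul_le_mul_of_nonneg_left
          (sum_mul_pow_four_le _ hp0) measureReal_nonneg
    _ = (∑ k, kernel α β E N t a k) ^ 3 * ∑ k : Fin N, kernel α β E N t a k *
        ∑ ζ, (μ N).real {ζ} * (Real.exp (logRate E N * height ζ k) - lam 0 k) ^ 4 := by
        simp only [Finset.mul_sum]
        rw [Finset.sum_comm]
        exact Finset.sum_congr rfl fun k _ => Finset.sum_congr rfl fun ζ _ => by ring
    _ ≤ (∑ k, kernel α β E N t a k) ^ 3 * ∑ k : Fin N, kernel α β E N t a k * D := by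
        gcongr with k _
        · exact hp0 k
        · exact sum_initial_error_le hE hN hρ hμ hlam k.2
    _ = (∑ k, kernel α β E N t a k) ^ 4 * D := by rw [← Finset.sum_mul]; ring
    _ ≤ _ := by gcongr

/-- A bound for `N ^ 2` times the fourth moments of `ξ_t - λ_t` up to time `T`, when the initial
fluctuations have fourth moments at most `A`. -/
noncomputable def finalConst (E T A : ℝ) : ℝ :=
  Real.exp ((1 + E) * (4 * E ^ 2) * energyBound E T) *
    (rowBound E T ^ 4 * ((Real.exp E * E) ^ 4 * |A|)
      + noiseBound E T * momentBound E T * energyBound E T)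

/-- The fourth moment inequality with `v = N`: the rate of growth is then of order `N` times the
squared kernel, hence integrable in time uniformly in `N`, while the noise contributes `1 / N` for
the bracket and another `1 / N` for the kernel. -/
theorem integral_xi_sub_pow_four_le (hE : 0 < E) (hα : α ∈ Ioo (0 : ℝ) 1)
    (hβ : β ∈ Ioo (0 : ℝ) 1) (hN : 3 ≤ N) (hN' : 6 * E + 6 ≤ N) {ρ₀ : ℝ → ℝ} {A T : ℝ}
    (hN1 : (1 + E) * (4 * E ^ 2) * energyBound E T ≤ N)
    (hN2 : 2 * (Real.exp 1 * (noiseBound E T * energyBound E T)) ≤ N)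
    (hρ : ∀ x ∈ Icc (0 : ℝ) 1, ρ₀ x ∈ Icc (0 : ℝ) 1) {μ : (N : ℕ) → Measure (Config N)}
    [IsProbabilityMeasure (μ N)] (hμ : InitialBound ρ₀ A μ) {lam : ℝ → ℕ → ℝ}
    (hlam : IsLinearSolution α β E N ρ₀ lam) (hX : IsExclusionProcess α β E N (μ N) P X)
    {t : ℝ≥0} (htT : (t : ℝ) ≤ T) {j : ℕ} (hj : j < N) :
    Integrable (fun ω => (xi E (fun s => X s ω) t j - lam t j) ^ 4) P ∧
      ∫ ω, (xi E (fun s => X s ω) t j - lam t j) ^ 4 ∂P ≤ finalConst E T A / (N : ℝ) ^ 2 := by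
  have hNpos : (0 : ℝ) < N := by positivity
  have ht : (0 : ℝ) ≤ t := t.2
  set a : Fin N := ⟨j, hj⟩ with ha
  have hfatou := integrable_and_integral_le hN hj hX t (G := quartic (weight E j a) (lam t a))
    fun ζ x _ => by rw [polyEval_quartic]; positivity
  have hwa : ∀ ζ : Config N, weight E j a ζ = 1 := weight_self j
  simp only [polyEval_quartic, hwa, one_mul] at hfatou
  refine ⟨hfatou.1, hfatou.2.trans ?_⟩
  have hMb := polyMoment_weight_le_momentBound hE hα hβ hN hN' hj hX (ht.trans htT) hN1 hN2
  have h := polyMoment_weight_le hE hα hβ hN hj hX a ht (lam t a) (v := N) hNpos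
    (fun s hs k => kernel_le_rowBound hE hα hβ hN hN' hs.1 (hs.2.trans htT) a k)
    (momentBound_pos E T).le fun s hs k => hMb s ⟨hs.1, hs.2.trans htT⟩ k
  have hI : ∫ s in (0 : ℝ)..t, ∑ k, kernel α β E N (t - s) a k ^ 2 ≤ energyBound E T / N :=
    integral_kernel_sq_le_energyBound hE hα hβ hN ht htT a
  have hI0 : 0 ≤ ∫ s in (0 : ℝ)..t, ∑ k, kernel α β E N (t - s) a k ^ 2 :=
    integral_kernel_sq_nonneg ht a
  set I := ∫ s in (0 : ℝ)..t, ∑ k, kernel α β E N (t - s) a k ^ 2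
  have hinit := polyMoment_dualField_initial_le hE hα hβ hN hN' hρ hμ hlam j ht htT a
  have hexp : Real.exp ((1 + E) * (4 * E ^ 2 * N) * I)
      ≤ Real.exp ((1 + E) * (4 * E ^ 2) * energyBound E T) := by
    refine Real.exp_le_exp.2 ?_
    calc (1 + E) * (4 * E ^ 2 * N) * I ≤ (1 + E) * (4 * E ^ 2 * N) * (energyBound E T / N) := by
          gcongr
      _ = _ := by field_simp
  have hnb := noiseBound_pos hE T
  have hmb := momentBound_pos E T
  have hcoef : (1 + E) * (4 * E ^ 2 / N + 3 * E ^ 4 * rowBound E T ^ 2 / N ^ 2)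
      ≤ noiseBound E T / N := by
    have h1 : 3 * E ^ 4 * rowBound E T ^ 2 / (N : ℝ) ^ 2 ≤ 3 * E ^ 4 * rowBound E T ^ 2 / N := by
      have h2 : (N : ℝ) ≤ N ^ 2 := le_self_pow₀ (by exact_mod_cast (by omega : 1 ≤ N)) two_ne_zero
      gcongr
    unfold noiseBound
    have e : (1 + E) * (4 * E ^ 2 + 3 * E ^ 4 * rowBound E T ^ 2) / N
        = (1 + E) * (4 * E ^ 2 / N + 3 * E ^ 4 * rowBound E T ^ 2 / N) := by ring
    rw [e]
    gcongr
  have hnoise : (1 + E) * (4 * E ^ 2 / N + 3 * E ^ 4 * rowBound E T ^ 2 / N ^ 2) *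
      momentBound E T * I ≤ noiseBound E T / N * momentBound E T * (energyBound E T / N) := by
    gcongr
  have h0 : 0 ≤ polyMoment α β E N j (μ N) 0 (quartic (dualField α β E j a t 0) (lam t a)) :=
    polyMoment_nonneg hN hj hX le_rfl fun ζ x _ => by rw [polyEval_quartic]; positivity
  refine h.trans ((mul_le_mul hexp (add_le_add hinit hnoise) (by positivity)
    (Real.exp_pos _).le).trans (le_of_eq ?_))
  unfold finalConst
  field_simp

end Path

end WASEP

theorem mainTheorem6 (E β T A₂ : ℝ) (hE : 0 < E) (hβ : β ∈ Ioo (0 : ℝ) 1) (hT : 0 < T) :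
    ∃ (C₁ : ℝ) (N₀ : ℕ), 3 ≤ N₀ ∧
      ∀ (α : ℝ), α ∈ Ioo (0 : ℝ) 1 →
      ∀ (ρ₀ : ℝ → ℝ), ContDiffOn ℝ 4 ρ₀ (Icc 0 1) → (∀ x ∈ Icc (0 : ℝ) 1, ρ₀ x ∈ Icc (0 : ℝ) 1) →
        ρ₀ 0 = α → ρ₀ 1 = β →
      ∀ (μ : (N : ℕ) → Measure (WASEP.Config N)), (∀ N, IsProbabilityMeasure (μ N)) →
        WASEP.InitialBound ρ₀ A₂ μ →
      ∀ (N : ℕ), N₀ ≤ N →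
      ∀ (lam : ℝ → ℕ → ℝ), WASEP.IsLinearSolution α β E N ρ₀ lam →
      ∀ (S : Type*) [MeasurableSpace S] (P : Measure S) [IsProbabilityMeasure P]
        (X : ℝ≥0 → S → WASEP.Config N), WASEP.IsExclusionProcess α β E N (μ N) P X →
      ∀ (t : ℝ≥0), (t : ℝ) ≤ T → ∀ (j : ℕ), j < N →
        Integrable (fun ω => (WASEP.xi E (fun s => X s ω) t j - lam t j) ^ 4) P ∧
        ∫ ω, (WASEP.xi E (fun s => X s ω) t j - lam t j) ^ 4 ∂P ≤ C₁ / (N : ℝ) ^ 2 := by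
  obtain ⟨N₁, hN₁⟩ := exists_nat_ge (max (6 * E + 6)
    (max ((1 + E) * (4 * E ^ 2) * WASEP.energyBound E T)
      (2 * (Real.exp 1 * (WASEP.noiseBound E T * WASEP.energyBound E T)))))
  refine ⟨WASEP.finalConst E T A₂, max 3 N₁, le_max_left _ _, ?_⟩
  intro α hα ρ₀ _ hρ _ _ μ hμp hμ N hN lam hlam S _ P _ X hX t htT j hj
  have hprob := hμp N
  have hN1 : (N₁ : ℝ) ≤ N := by exact_mod_cast (le_max_right 3 N₁).trans hN
  have hle := hN₁.trans hN1
  exact WASEP.integral_xi_sub_pow_four_le hE hα hβ ((le_max_left 3 N₁).trans hN)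
    ((le_max_left _ _).trans hle) ((le_max_left _ _).trans ((le_max_right _ _).trans hle))
    ((le_max_right _ _).trans ((le_max_right _ _).trans hle)) hρ hμ hlam hX htT hj
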